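/- Let $\alpha,\beta,\sigma>0$, $\theta=(\alpha,\beta,\sigma)$, and consider the exponentiated Weibull distribution EWD$(\theta)$ on $(0,\infty)$ with distribution function and density $$F(x;\theta)=\bigl[1-e^{-(x/\sigma)^\beta}\bigr]^\alpha,\qquad f(x;\theta)=\frac{\alpha\beta}{\sigma}\Bigl(\frac x\sigma\Bigr)^{\beta-1}e^{-(x/\sigma)^\beta}\bigl[1-e^{-(x/\sigma)^\beta}\bigr]^{\alpha-1},\quad x>0 .$$ For $1\le r\le n$, let $x_{1:n}\le\dots\le x_{r:n}$ be the first $r$ order statistics of $n$ independent EWD$(\theta)$ lifetimes (type II censoring), with likelihood $$L_{n,r}(\theta)=\frac{n!}{(n-r)!}\prod_{i=1}^r f(x_{i:n};\theta)\,\bigl[1-F(x_{r:n};\theta)\bigr]^{n-r},$$ and let $I_{n,r}(\theta)=\Bigl[E_\theta\bigl(\partial_{\theta_i}\ln L_{n,r}(\theta)\,\partial_{\theta_j}\ln L_{n,r}(\theta)\bigr)\Bigr]_{i,j=1}^{3}$ be the Fisher information matrix in these order statistics. Put $$\psi(z;\alpha)=1+\ln(1-z)\left[1+\frac{1-z}{z}\left(1-\frac{\alpha}{1-z^\alpha}\right)\right].$$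 **Theorem.** Let $p\in(0,1)$. For every sequence $r=r_n$ with $r_n/n\to p$, the matrices $I_{n,r_n}(\theta)$ are well defined whenever $1\le r_n\le n$ (almost surely the partial derivatives of $\ln L_{n,r_n}$ at $\theta$ exist, and their pairwise products are integrable), and $\frac1n I_{n,r_n}(\theta)$ converges as $n\to\infty$ to a symmetric matrix $I_p(\theta)=[I_p^{ij}(\theta)]$, the limiting Fisher information matrix, which does not depend on the choice of the sequence and has the entries $$I_p^{11}=\frac1{\alpha^2}\int_0^p\Bigl[1+\frac{\ln x}{1-x}\Bigr]^2dx,$$ $$I_p^{22}=\frac{\alpha}{\beta^2}\int_0^{p^{1/\alpha}}\bigl\{1+\ln[-\ln(1-x)]\,\psi(x;\alpha)\bigr\}^2x^{\alpha-1}\,dx,$$ $$I_p^{33}=\alpha\Bigl(\frac\beta\sigma\Bigr)^2\int_0^{p^{1/\alpha}}\psi^2(x;\alpha)\,x^{\alpha-1}\,dx,$$ $$I_p^{12}=I_p^{21}=\frac\alpha\beta\int_0^{p^{1/\alpha}}\Bigl(\frac1\alpha+\frac{\ln x}{1-x^\alpha}\Bigr)\bigl\{1+\ln[-\ln(1-x)]\,\psi(x;\alpha)\bigr\}x^{\alpha-1}\,dx,$$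 $$I_p^{13}=I_p^{31}=-\frac{\alpha\beta}\sigma\int_0^{p^{1/\alpha}}\Bigl(\frac1\alpha+\frac{\ln x}{1-x^\alpha}\Bigr)\psi(x;\alpha)\,x^{\alpha-1}\,dx,$$ $$I_p^{23}=I_p^{32}=-\frac\alpha\sigma\int_0^{p^{1/\alpha}}\bigl\{1+\ln[-\ln(1-x)]\,\psi(x;\alpha)\bigr\}\psi(x;\alpha)\,x^{\alpha-1}\,dx,$$ where all these integrals converge absolutely. -/

import Mathlib

open MeasureTheory Filter Topology

noncomputable section

namespace EWD

/-- Cumulative distribution function `F(x; θ)` of the exponentiated Weibull distribution with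
parameter vector `θ = (α, β, σ) = (θ 0, θ 1, θ 2)`. -/
def cdf (θ : Fin 3 → ℝ) (x : ℝ) : ℝ :=
  if 0 < x then (1 - Real.exp (-(x / θ 2) ^ θ 1)) ^ θ 0 else 0

/-- Density `f(x; θ)` of the exponentiated Weibull distribution. -/
def pdf (θ : Fin 3 → ℝ) (x : ℝ) : ℝ :=
  if 0 < x then
    θ 0 * θ 1 / θ 2 * (x / θ 2) ^ (θ 1 - 1) * Real.exp (-(x / θ 2) ^ θ 1) *
      (1 - Real.exp (-(x / θ 2) ^ θ 1)) ^ (θ 0 - 1)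
  else 0

/-- The exponentiated Weibull distribution as a measure on `ℝ`. -/
def law (θ : Fin 3 → ℝ) : Measure ℝ :=
  volume.withDensity fun x => ENNReal.ofReal (pdf θ x)

/-- The joint law of `n` independent lifetimes with the exponentiated Weibull distribution. -/
def sampleLaw (θ : Fin 3 → ℝ) (n : ℕ) : Measure (Fin n → ℝ) :=
  Measure.pi fun _ => law θ

/-- The `i`-th order statistic `x_{i:n}` of `x₁, …, xₙ`, for `1 ≤ i ≤ n` (and `0` for other `i`). -/
def orderStat {n : ℕ} (x : Fin n → ℝ) (i : ℕ) : ℝ :=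
  if h : 1 ≤ i ∧ i ≤ n then x (Tuple.sort x ⟨i - 1, by omega⟩) else 0

/-- The likelihood of the type II censored data `y 1 ≤ ⋯ ≤ y r`, the first `r` order statistics
of a sample of size `n`. -/
def likelihood (n r : ℕ) (y : ℕ → ℝ) (θ : Fin 3 → ℝ) : ℝ :=
  (n.factorial : ℝ) / ((n - r).factorial : ℝ) * (∏ i ∈ Finset.Icc 1 r, pdf θ (y i)) *
    (1 - cdf θ (y r)) ^ (n - r)

/-- The log-likelihood as a function of the `i`-th coordinate of the parameter vector alone. -/
def logLikelihoodAlong (n r : ℕ) (y : ℕ → ℝ) (θ : Fin 3 → ℝ) (i : Fin 3) (t : ℝ) : ℝ :=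
  Real.log (likelihood n r y (Function.update θ i t))

/-- The score: the partial derivative of the log-likelihood in the `i`-th parameter at `θ`. -/
def score (n r : ℕ) (y : ℕ → ℝ) (θ : Fin 3 → ℝ) (i : Fin 3) : ℝ :=
  deriv (logLikelihoodAlong n r y θ i) (θ i)

/-- The Fisher information matrix about `θ` in the first `r` order statistics of a sample of
size `n`: the expectation under `θ` of the products of the components of the score. -/
def fisherInformation (θ : Fin 3 → ℝ) (n r : ℕ) : Matrix (Fin 3) (Fin 3) ℝ :=
  Matrix.of fun i j =>
    ∫ x, score n r (orderStat x) θ i * score n r (orderStat x) θ j ∂(sampleLaw θ n)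

/-- The Fisher information matrix of the first `r` of `n` order statistics is well defined:
almost surely all the partial derivatives of the log-likelihood exist at `θ`, and their pairwise
products are integrable. -/
def FisherInformationExists (θ : Fin 3 → ℝ) (n r : ℕ) : Prop :=
  (∀ᵐ x ∂(sampleLaw θ n), ∀ i, DifferentiableAt ℝ (logLikelihoodAlong n r (orderStat x) θ i) (θ i)) ∧
    ∀ i j, Integrable
      (fun x => score n r (orderStat x) θ i * score n r (orderStat x) θ j) (sampleLaw θ n)

/-- `I` is the limiting Fisher information matrix (per observation) under type II censoring with
limiting observed fraction `p`: whenever `r n / n → p`, the Fisher information matrices of the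
first `r n` of `n` order statistics are well defined and, divided by `n`, converge to `I`. -/
def IsLimitingFisherInformation (θ : Fin 3 → ℝ) (p : ℝ) (I : Matrix (Fin 3) (Fin 3) ℝ) : Prop :=
  ∀ r : ℕ → ℕ, Tendsto (fun n : ℕ => (r n : ℝ) / (n : ℝ)) atTop (𝓝 p) →
    (∀ n, 1 ≤ r n → r n ≤ n → FisherInformationExists θ n (r n)) ∧
      Tendsto (fun n : ℕ => (n : ℝ)⁻¹ • fisherInformation θ n (r n)) atTop (𝓝 I)

/-- The auxiliary function `ψ(z; α)`. -/
def psi (z α : ℝ) : ℝ :=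
  1 + Real.log (1 - z) * (1 + (1 - z) / z * (1 - α / (1 - z ^ α)))

end EWD

end

/-!
The theorem holds because the censored score is a martingale integral against the counting process
of the lifetimes, which gives its covariance in closed form for every `n` and `r`; the limit is
then a law of large numbers.

The distribution function `F` maps the lifetimes to independent uniform variables `v₁, …, vₙ` and
commutes with order statistics (`measurePreserving_cdf_sample`, `orderStat_comp`). On this scale,
let `ρᵢ` be the partial derivative of the log-hazard `log (f / (1 - F))` in the `i`-th parameter.
The derivative of `log (1 - F)` at `s` is `-H(s)`, where `H(s) = ∫₀ˢ ρᵢ(t) / (1 - t) dt` is the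
compensator of `ρᵢ`, and the derivative of `log f` is `ρᵢ - H` (`compensator_unifScore`,
`compensated_unifScore`). Hence the score is
`∑_{k ≤ r} (ρᵢ - H)(v_{k:n}) - (n - r) H(v_{r:n})`.

Let `qⱼ(s)` indicate that fewer than `r` of the variables other than `vⱼ` are below `s`. Without
ties the score equals `∑ⱼ Φⱼ`, where `Φⱼ` is the compensated version of `ρᵢ qⱼ`, evaluated at `vⱼ`
(`totalContribution_eq`). Given the other variables, `Φⱼ` is centred, and its second moment is
`∫ ρᵢ² qⱼ`, because `g ↦ g - ∫ g / (1 - s) ds` is an isometry of `L²(0, 1)`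
(`integral_sq_compensated`; square integrability of the compensator is Hardy's inequality,
`memLp_compensator_abs`). Different `Φⱼ` are orthogonal (`integral_contribution_mul_contribution`),
by a computation in two variables with all others fixed (`integral_compensated_mul_compensated`).
Polarization gives
`E[Sᵢ Sₖ] = ∑ⱼ ∫ ρᵢ(s) ρₖ(s) P(fewer than r of the others are below s) ds`.

If `r / n → p`, the probability tends to `1` for `s < p` and to `0` for `s > p` by Chebyshev's
inequality, and dominated convergence yields the limit `∫₀ᵖ ρᵢ ρₖ`
(`tendsto_integral_totalContribution_mul`). The stated formulas follow by the substitution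
`s = x ^ α`. The functions `ρᵢ` are square integrable as they grow at most like squares of
logarithms at `0` and `1` (`exists_abs_hazardScore_le`).
-/

noncomputable section

namespace EWD

/-! ### The compensator on the unit interval -/

/-- The uniform distribution on `(0, 1)`, as a measure on `ℝ`. -/
def unif : Measure ℝ := volume.restrict (Set.Ioo 0 1)

instance : IsProbabilityMeasure unif := ⟨by simp [unif]⟩

instance : NullSingletonClass unif := by unfold unif; infer_instance

lemma ae_unif_mem : ∀ᵐ x ∂unif, x ∈ Set.Ioo (0 : ℝ) 1 := ae_restrict_mem measurableSet_Ioo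

lemma Ioi_inter_Ioo_zero_one {s : ℝ} (hs : s ∈ Set.Ioo (0 : ℝ) 1) :
    Set.Ioi s ∩ Set.Ioo 0 1 = Set.Ioo s 1 := by
  ext x; simp only [Set.mem_inter_iff, Set.mem_Ioi, Set.mem_Ioo]
  exact ⟨fun h => ⟨h.1, h.2.2⟩, fun h => ⟨h.1, hs.1.trans h.1, h.2⟩⟩

lemma Iio_inter_Ioo_zero_one {s : ℝ} (hs : s ∈ Set.Ioo (0 : ℝ) 1) :
    Set.Iio s ∩ Set.Ioo 0 1 = Set.Ioo 0 s := by
  ext x; simp only [Set.mem_inter_iff, Set.mem_Iio, Set.mem_Ioo]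
  exact ⟨fun h => ⟨h.2.1, h.1⟩, fun h => ⟨h.2, h.1, h.2.trans hs.2⟩⟩

lemma unif_real_Ioi {s : ℝ} (hs : s ∈ Set.Ioo (0 : ℝ) 1) : unif.real (Set.Ioi s) = 1 - s := by
  rw [measureReal_def, unif, Measure.restrict_apply measurableSet_Ioi, Ioi_inter_Ioo_zero_one hs,
    Real.volume_Ioo, ENNReal.toReal_ofReal (by linarith [hs.2])]

lemma unif_real_Iio {s : ℝ} (hs : s ∈ Set.Ioo (0 : ℝ) 1) : unif.real (Set.Iio s) = s := by
  rw [measureReal_def, unif, Measure.restrict_apply measurableSet_Iio, Iio_inter_Ioo_zero_one hs,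
    Real.volume_Ioo, sub_zero, ENNReal.toReal_ofReal hs.1.le]

lemma setIntegral_unif_Ioi {s : ℝ} (hs : s ∈ Set.Ioo (0 : ℝ) 1) (w : ℝ → ℝ) :
    ∫ x in Set.Ioi s, w x ∂unif = ∫ x in s..1, w x := by
  rw [unif, Measure.restrict_restrict measurableSet_Ioi, Ioi_inter_Ioo_zero_one hs,
    intervalIntegral.integral_of_le hs.2.le, integral_Ioc_eq_integral_Ioo]

lemma setIntegral_unif_Iio {s : ℝ} (hs : s ∈ Set.Ioo (0 : ℝ) 1) (w : ℝ → ℝ) :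
    ∫ x in Set.Iio s, w x ∂unif = ∫ x in 0..s, w x := by
  rw [unif, Measure.restrict_restrict measurableSet_Iio, Iio_inter_Ioo_zero_one hs,
    intervalIntegral.integral_of_le hs.1.le, integral_Ioc_eq_integral_Ioo]

lemma measurable_setIntegral_Iio {φ : ℝ → ℝ} (hφ : Measurable φ) :
    Measurable fun x => ∫ s in Set.Iio x, φ s ∂unif := by
  have h : StronglyMeasurable (Function.uncurry fun x s : ℝ => (Set.Iio x).indicator φ s) := by
    apply Measurable.stronglyMeasurable
    have : (Function.uncurry fun x s : ℝ => (Set.Iio x).indicator φ s) =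
        Set.indicator {q : ℝ × ℝ | q.2 < q.1} (fun q => φ q.2) := by
      ext ⟨x, s⟩; simp [Set.indicator]
    rw [this]
    exact (hφ.comp measurable_snd).indicator (measurableSet_lt measurable_snd measurable_fst)
  have := (h.integral_prod_right (ν := unif)).measurable
  simpa only [integral_indicator measurableSet_Iio] using this

/-- Fubini's theorem on the triangle `s < x`. The factor `1 - s` is the mass of `(s, 1)`. -/
lemma integral_mul_setIntegral_Iio {w φ : ℝ → ℝ} (hw : Measurable w) (hw0 : ∀ x, |w x| ≤ 1)
    (hφ : Measurable φ) (hint : Integrable (fun s => φ s * (1 - s)) unif) :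
    Integrable (fun x => w x * ∫ s in Set.Iio x, φ s ∂unif) unif ∧
    ∫ x, w x * ∫ s in Set.Iio x, φ s ∂unif ∂unif =
      ∫ s, φ s * ∫ x in Set.Ioi s, w x ∂unif ∂unif := by
  set f : ℝ × ℝ → ℝ := Set.indicator {q : ℝ × ℝ | q.2 < q.1} (fun q => w q.1 * φ q.2) with hf
  have hfm : Measurable f :=
    ((hw.comp measurable_fst).mul (hφ.comp measurable_snd)).indicator
      (measurableSet_lt measurable_snd measurable_fst)
  have e1 : ∀ x, (fun s => f (x, s)) = (Set.Iio x).indicator fun s => w x * φ s := by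
    intro x; ext s; simp [hf, Set.indicator]
  have e2 : ∀ s, (fun x => f (x, s)) = (Set.Ioi s).indicator fun x => w x * φ s := by
    intro x; ext s; simp [hf, Set.indicator]
  have hb : ∀ s x, ‖f (x, s)‖ ≤ (Set.Ioi s).indicator (fun _ => |φ s|) x := by
    intro s x
    by_cases h : s < x
    · simpa [hf, h, abs_mul] using mul_le_mul_of_nonneg_right (hw0 x) (abs_nonneg (φ s))
    · simp [hf, h]
  have hfi : Integrable f (unif.prod unif) := by
    rw [integrable_prod_iff' hfm.aestronglyMeasurable]
    have h1 : ∀ s, Integrable (fun x => f (x, s)) unif := fun s =>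
      Integrable.of_bound (hfm.comp measurable_prodMk_right).aestronglyMeasurable |φ s|
        (ae_of_all _ fun x => (hb s x).trans
          (Set.indicator_le_self' (fun _ _ => abs_nonneg _) x))
    refine ⟨ae_of_all _ h1, ?_⟩
    refine Integrable.mono' hint.norm ?_ ?_
    · exact (hfm.norm.stronglyMeasurable.integral_prod_left
        (μ := unif) (f := fun x s => ‖f (x, s)‖)).aestronglyMeasurable
    · filter_upwards [ae_unif_mem] with s hs
      rw [Real.norm_of_nonneg (integral_nonneg fun _ => norm_nonneg _)]
      calc ∫ x, ‖f (x, s)‖ ∂unif ≤ ∫ x, (Set.Ioi s).indicator (fun _ => |φ s|) x ∂unif :=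
            integral_mono (h1 s).norm ((integrable_const _).indicator measurableSet_Ioi) (hb s)
        _ = ‖φ s * (1 - s)‖ := by
            rw [integral_indicator measurableSet_Ioi, setIntegral_const, unif_real_Ioi hs,
              Real.norm_eq_abs, abs_mul, abs_of_nonneg (by linarith [hs.2] : 0 ≤ 1 - s),
              smul_eq_mul, mul_comm]
  have i1 : ∀ x, ∫ s, f (x, s) ∂unif = w x * ∫ s in Set.Iio x, φ s ∂unif := fun x => by
    rw [e1, integral_indicator measurableSet_Iio, integral_const_mul]
  have i2 : ∀ s, ∫ x, f (x, s) ∂unif = φ s * ∫ x in Set.Ioi s, w x ∂unif := fun x => by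
    rw [e2, integral_indicator measurableSet_Ioi, integral_mul_const, mul_comm]
  constructor
  · simpa only [i1] using hfi.integral_prod_left
  · have := integral_integral_swap (f := fun x s => f (x, s)) hfi
    simpa only [i1, i2] using this

/-- The square of an integral over `(-∞, x)` is twice an integral over the triangle `t < s < x`. -/
lemma sq_setIntegral_Iio {k : ℝ → ℝ} {x : ℝ}
    (hint : IntegrableOn k (Set.Iio x) unif) :
    (∫ s in Set.Iio x, k s ∂unif) ^ 2 =
      2 * ∫ s in Set.Iio x, k s * ∫ t in Set.Iio s, k t ∂unif ∂unif := by
  set ν := unif.restrict (Set.Iio x) with hν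
  have hp : Integrable (fun q : ℝ × ℝ => k q.1 * k q.2) (ν.prod ν) := hint.mul_prod hint
  have hms : MeasurableSet {q : ℝ × ℝ | q.2 < q.1} := measurableSet_lt measurable_snd measurable_fst
  have hms' : MeasurableSet {q : ℝ × ℝ | q.1 < q.2} :=
    measurableSet_lt measurable_fst measurable_snd
  have hin : ∀ s ∈ Set.Iio x, ∫ t in Set.Iio s, k t ∂ν = ∫ t in Set.Iio s, k t ∂unif := by
    intro s hs
    rw [hν, Measure.restrict_restrict measurableSet_Iio,
      Set.inter_eq_left.2 (Set.Iio_subset_Iio (le_of_lt hs))]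
  have hlow : ∫ q in {q : ℝ × ℝ | q.2 < q.1}, k q.1 * k q.2 ∂(ν.prod ν) =
      ∫ s in Set.Iio x, k s * ∫ t in Set.Iio s, k t ∂unif ∂unif := by
    rw [← integral_indicator hms, integral_prod _ (hp.indicator hms)]
    refine setIntegral_congr_fun measurableSet_Iio fun s hs => ?_
    have : (fun t => Set.indicator {q : ℝ × ℝ | q.2 < q.1} (fun q => k q.1 * k q.2) (s, t)) =
        (Set.Iio s).indicator fun t => k s * k t := by ext t; simp [Set.indicator]
    simp only [this]
    rw [integral_indicator measurableSet_Iio, integral_const_mul, hin s hs]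
  have hswap : ∫ q in {q : ℝ × ℝ | q.1 < q.2}, k q.1 * k q.2 ∂(ν.prod ν) =
      ∫ q in {q : ℝ × ℝ | q.2 < q.1}, k q.1 * k q.2 ∂(ν.prod ν) := by
    rw [← integral_indicator hms, ← integral_indicator hms', ← integral_prod_swap]
    refine integral_congr_ae (ae_of_all _ fun q => ?_)
    simp [Set.indicator, mul_comm]
  have hdiag : ∀ᵐ q ∂(ν.prod ν), q.1 ≠ q.2 := by
    have : MeasurableSet {q : ℝ × ℝ | q.1 ≠ q.2} :=
      (measurableSet_eq_fun measurable_fst measurable_snd).compl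
    rw [Measure.ae_prod_iff_ae_ae this]
    refine ae_of_all _ fun s => ?_
    have : ∀ᵐ t ∂ν, t ≠ s := ae_restrict_of_ae (by simp [ae_iff])
    filter_upwards [this] with t ht using ht.symm
  have hdec : ∫ q, k q.1 * k q.2 ∂(ν.prod ν) =
      ∫ q in {q : ℝ × ℝ | q.2 < q.1}, k q.1 * k q.2 ∂(ν.prod ν) +
      ∫ q in {q : ℝ × ℝ | q.1 < q.2}, k q.1 * k q.2 ∂(ν.prod ν) := by
    rw [← integral_indicator hms, ← integral_indicator hms',
      ← integral_add (hp.indicator hms) (hp.indicator hms')]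
    refine integral_congr_ae ?_
    filter_upwards [hdiag] with q hq
    rcases lt_or_gt_of_ne hq with h | h
    · simp [Set.indicator, h, h.not_gt]
    · simp [Set.indicator, h, h.not_gt]
  have := integral_prod_mul (μ := ν) (ν := ν) k k
  rw [sq, ← this, hdec, hswap, hlow]; ring

/-- The compensator `x ↦ ∫_{s < x} g(s) / (1 - s) ds` of `g`: the integral of `g` with respect to
the cumulative hazard of the uniform distribution. -/
def compensator (g : ℝ → ℝ) (x : ℝ) : ℝ := ∫ s in Set.Iio x, g s / (1 - s) ∂unif

/-- The compensated version `g - ∫_{s < ·} g(s) / (1 - s) ds` of `g`. -/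
def compensated (g : ℝ → ℝ) (x : ℝ) : ℝ := g x - compensator g x

lemma measurable_compensator {g : ℝ → ℝ} (hg : Measurable g) : Measurable (compensator g) :=
  measurable_setIntegral_Iio (hg.div (measurable_const.sub measurable_id))

lemma integrableOn_div_Iio {g : ℝ → ℝ} (hg : Integrable g unif) {x : ℝ} (hx : x < 1) :
    IntegrableOn (fun s => g s / (1 - s)) (Set.Iio x) unif := by
  have hx' : 0 < 1 - x := by linarith
  refine Integrable.mono' (hg.norm.integrableOn.div_const (1 - x))
    ((hg.aestronglyMeasurable.aemeasurable.div
      (measurable_const.sub measurable_id).aemeasurable).aestronglyMeasurable.restrict) ?_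
  filter_upwards [ae_restrict_mem measurableSet_Iio] with s hs
  have hs' : s < x := hs
  rw [norm_div, Real.norm_of_nonneg (by linarith : 0 ≤ 1 - s)]
  gcongr

lemma abs_compensator_le {g G : ℝ → ℝ} (hG : Integrable G unif)
    (h : ∀ x, |g x| ≤ G x) {x : ℝ} (hx : x < 1) : |compensator g x| ≤ compensator G x := by
  unfold compensator
  rw [← Real.norm_eq_abs]
  refine norm_integral_le_of_norm_le (integrableOn_div_Iio hG hx) ?_
  filter_upwards [ae_restrict_mem measurableSet_Iio] with s hs
  have hs' : s < x := hs
  rw [norm_div, Real.norm_of_nonneg (by linarith : 0 ≤ 1 - s), Real.norm_eq_abs]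
  have : 0 < 1 - s := by linarith
  gcongr
  exact h s

lemma compensator_congr {g g' : ℝ → ℝ} {x : ℝ} (h : ∀ s < x, g s = g' s) :
    compensator g x = compensator g' x :=
  setIntegral_congr_fun measurableSet_Iio fun s hs => by rw [h s hs]

/-- The mean of the compensator of `g` is the mean of `g`. -/
lemma integral_compensator {g : ℝ → ℝ} (hg : Measurable g) (hi : Integrable g unif) :
    Integrable (compensator g) unif ∧ ∫ x, compensator g x ∂unif = ∫ x, g x ∂unif := by
  have hcongr : (fun s => g s / (1 - s) * (1 - s)) =ᵐ[unif] g := by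
    filter_upwards [ae_unif_mem] with s hs
    exact div_mul_cancel₀ _ (by linarith [hs.2])
  have := integral_mul_setIntegral_Iio (w := fun _ => 1) (φ := fun s => g s / (1 - s))
    measurable_const (by simp) (hg.div (measurable_const.sub measurable_id))
    ((integrable_congr hcongr).2 hi)
  simp only [one_mul] at this
  refine ⟨this.1, this.2.trans (integral_congr_ae ?_)⟩
  filter_upwards [ae_unif_mem] with s hs
  rw [setIntegral_const, unif_real_Ioi hs, smul_eq_mul, mul_one]
  exact div_mul_cancel₀ _ (by linarith [hs.2])

/-- Integrating the square of the compensator against a weight reduces to one factor. -/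
lemma integral_mul_sq_compensator {g w : ℝ → ℝ} (hw : Measurable w) (hw0 : ∀ x, |w x| ≤ 1)
    (hg : Measurable g) (hi : Integrable g unif)
    (hgH : Integrable (fun x => g x * compensator g x) unif) :
    ∫ x, w x * compensator g x ^ 2 ∂unif =
      2 * ∫ s, g s / (1 - s) * compensator g s * ∫ x in Set.Ioi s, w x ∂unif ∂unif := by
  have hcongr : (fun s => g s / (1 - s) * compensator g s * (1 - s)) =ᵐ[unif]
      fun x => g x * compensator g x := by
    filter_upwards [ae_unif_mem] with s hs
    have : 1 - s ≠ 0 := by linarith [hs.2]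
    field_simp
  have hk : Measurable fun s => g s / (1 - s) := hg.div (measurable_const.sub measurable_id)
  rw [← (integral_mul_setIntegral_Iio (φ := fun s => g s / (1 - s) * compensator g s) hw hw0
    (hk.mul (measurable_compensator hg))
    ((integrable_congr hcongr).2 hgH)).2, ← integral_const_mul]
  refine integral_congr_ae ?_
  filter_upwards [ae_unif_mem] with x hx
  have := sq_setIntegral_Iio (integrableOn_div_Iio hi hx.2)
  simp only [compensator] at this ⊢
  rw [this]; ring

lemma integral_sq_compensator {g : ℝ → ℝ} (hg : Measurable g) (hi : Integrable g unif)
    (hgH : Integrable (fun x => g x * compensator g x) unif) :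
    ∫ x, compensator g x ^ 2 ∂unif = 2 * ∫ x, g x * compensator g x ∂unif := by
  have := integral_mul_sq_compensator (w := fun _ => 1) measurable_const (by simp) hg hi hgH
  simp only [one_mul] at this
  rw [this]
  congr 1
  refine integral_congr_ae ?_
  filter_upwards [ae_unif_mem] with s hs
  rw [setIntegral_const, unif_real_Ioi hs]
  have : 1 - s ≠ 0 := by linarith [hs.2]
  simp only [smul_eq_mul]
  field_simp

lemma integral_one_sub_mul_sq_compensator {g : ℝ → ℝ} (hg : Measurable g) (hi : Integrable g unif)
    (hgH : Integrable (fun x => g x * compensator g x) unif) :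
    ∫ x, (1 - x) * compensator g x ^ 2 ∂unif =
      ∫ x, (1 - x) * (g x * compensator g x) ∂unif := by
  -- the weight is truncated outside `(0, 1)`, where it need not be bounded by `1`
  have hmw : Measurable ((Set.Ioo (0 : ℝ) 1).indicator fun x => 1 - x) :=
    (measurable_const.sub measurable_id).indicator measurableSet_Ioo
  have hb : ∀ x, |(Set.Ioo (0 : ℝ) 1).indicator (fun x => 1 - x) x| ≤ 1 := by
    intro x
    by_cases h : x ∈ Set.Ioo (0 : ℝ) 1
    · rw [Set.indicator_of_mem h, abs_le]; constructor <;> linarith [h.1, h.2]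
    · simp [h]
  have := integral_mul_sq_compensator hmw hb hg hi hgH
  rw [integral_congr_ae (g := fun x => (1 - x) * compensator g x ^ 2)
    (by filter_upwards [ae_unif_mem] with x hx; rw [Set.indicator_of_mem hx])] at this
  rw [this, ← integral_const_mul]
  refine integral_congr_ae ?_
  filter_upwards [ae_unif_mem] with s hs
  have e : ∫ x in Set.Ioi s, (Set.Ioo (0 : ℝ) 1).indicator (fun x => 1 - x) x ∂unif =
      (1 - s) ^ 2 / 2 := by
    rw [integral_congr_ae (g := fun x => 1 - x) (ae_restrict_of_ae
      (by filter_upwards [ae_unif_mem] with x hx; rw [Set.indicator_of_mem hx])),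
      setIntegral_unif_Ioi hs, intervalIntegral.integral_sub (by simp) (by simp)]
    simp; ring
  rw [e]
  have : 1 - s ≠ 0 := by linarith [hs.2]
  field_simp

/-! ### Hardy's inequality, isometry and orthogonality -/

/-- **Hardy's inequality**: the compensator of a square integrable function is square integrable.
On `(-∞, M)` with `M < 1` it is bounded, so that `∫ H² = 2 ∫ g H ≤ 2 ∫ g² + ½ ∫ H²` may be solved
for `∫ H²`; the bound does not depend on `M`. -/
lemma memLp_compensator_abs {g : ℝ → ℝ} (hg : Measurable g) (h2 : MemLp g 2 unif) :
    MemLp (compensator fun x => |g x|) 2 unif := by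
  have hG : Measurable fun x => |g x| := hg.abs
  have hGi : Integrable (fun x => |g x|) unif := (h2.integrable one_le_two).abs
  have hsq : Integrable (fun x => g x ^ 2) unif := h2.integrable_sq
  have key : ∀ M < 1, IntegrableOn (fun x => compensator (fun x => |g x|) x ^ 2) (Set.Iio M) unif ∧
      ∫ x in Set.Iio M, compensator (fun x => |g x|) x ^ 2 ∂unif ≤ 4 * ∫ x, g x ^ 2 ∂unif := by
    intro M hM
    set GM : ℝ → ℝ := (Set.Iio M).indicator fun x => |g x| with hGM
    have hGMm : Measurable GM := hG.indicator measurableSet_Iio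
    have hGMi : Integrable GM unif := hGi.indicator measurableSet_Iio
    have hcM : Measurable (compensator GM) := measurable_compensator hGMm
    have hb : ∀ᵐ x ∂unif, ‖compensator GM x‖ ≤ compensator (fun x => |g x|) M := by
      filter_upwards [ae_unif_mem] with x hx
      have e : compensator GM x = ∫ s in Set.Iio x ∩ Set.Iio M, |g s| / (1 - s) ∂unif := by
        have : (fun s => GM s / (1 - s)) = (Set.Iio M).indicator fun s => |g s| / (1 - s) := by
          ext s; by_cases h : s < M <;> simp [hGM, h]
        rw [compensator, this, setIntegral_indicator measurableSet_Iio]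
      rw [e, Real.norm_of_nonneg (setIntegral_nonneg (measurableSet_Iio.inter measurableSet_Iio)
        fun s hs => ?_)]
      · refine setIntegral_mono_set (integrableOn_div_Iio hGi hM) ?_
          Set.inter_subset_right.eventuallyLE
        filter_upwards [ae_restrict_mem measurableSet_Iio] with s hs
        have : s < M := hs
        exact div_nonneg (abs_nonneg _) (by linarith)
      · have : s < M := hs.2
        exact div_nonneg (abs_nonneg _) (by linarith)
    have hc2 : Integrable (fun x => compensator GM x ^ 2) unif :=
      (MemLp.of_bound hcM.aestronglyMeasurable _ hb : MemLp _ 2 unif).integrable_sq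
    have hgc : Integrable (fun x => GM x * compensator GM x) unif :=
      hGMi.mul_bdd hcM.aestronglyMeasurable hb
    have hid := integral_sq_compensator hGMm hGMi hgc
    have hle : 2 * ∫ x, GM x * compensator GM x ∂unif ≤
        2 * ∫ x, g x ^ 2 ∂unif + (∫ x, compensator GM x ^ 2 ∂unif) / 2 := by
      rw [← integral_const_mul, ← integral_const_mul, ← integral_div,
        ← integral_add (hsq.const_mul 2) (hc2.div_const 2)]
      refine integral_mono (hgc.const_mul 2) ((hsq.const_mul 2).add (hc2.div_const 2)) fun x => ?_
      have h1 : GM x ^ 2 ≤ g x ^ 2 := by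
        by_cases h : x < M
        · simp [hGM, h]
        · simp [hGM, h, sq_nonneg]
      simp only
      nlinarith [sq_nonneg (2 * GM x - compensator GM x)]
    have hcongr : ∀ x ∈ Set.Iio M, compensator GM x ^ 2 = compensator (fun x => |g x|) x ^ 2 := by
      intro x hx
      rw [compensator_congr (g' := fun x => |g x|)]
      intro s hs
      have : s < M := hs.trans hx
      simp [hGM, this]
    refine ⟨(integrableOn_congr_fun hcongr measurableSet_Iio).1 hc2.integrableOn, ?_⟩
    rw [← setIntegral_congr_fun measurableSet_Iio hcongr]
    have := setIntegral_le_integral (s := Set.Iio M) hc2 (ae_of_all _ fun x => sq_nonneg _)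
    linarith
  have hlt : ∀ n : ℕ, 1 - 1 / ((n : ℝ) + 1) < 1 := fun n => by
    have : 0 < 1 / ((n : ℝ) + 1) := by positivity
    linarith
  have hcover : AECover unif atTop fun n : ℕ => Set.Iio (1 - 1 / ((n : ℝ) + 1)) := by
    refine ⟨?_, fun n => measurableSet_Iio⟩
    filter_upwards [ae_unif_mem] with x hx
    have : Tendsto (fun n : ℕ => 1 - 1 / ((n : ℝ) + 1)) atTop (𝓝 (1 - 0)) :=
      tendsto_const_nhds.sub tendsto_one_div_add_atTop_nhds_zero_nat
    exact this.eventually_const_lt (by linarith [hx.2])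
  refine (memLp_two_iff_integrable_sq (measurable_compensator hG).aestronglyMeasurable).2 ?_
  refine hcover.integrable_of_integral_norm_bounded (4 * ∫ x, g x ^ 2 ∂unif)
    (fun n => (key _ (hlt n)).1) (Eventually.of_forall fun n => ?_)
  simpa using (key _ (hlt n)).2

lemma memLp_compensator {g : ℝ → ℝ} (hg : Measurable g) (h2 : MemLp g 2 unif) :
    MemLp (compensator g) 2 unif := by
  refine (memLp_compensator_abs hg h2).mono' (measurable_compensator hg).aestronglyMeasurable ?_
  filter_upwards [ae_unif_mem] with x hx
  exact abs_compensator_le (h2.integrable one_le_two).abs (fun _ => le_rfl) hx.2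

lemma memLp_compensated {g : ℝ → ℝ} (hg : Measurable g) (h2 : MemLp g 2 unif) :
    MemLp (compensated g) 2 unif := h2.sub (memLp_compensator hg h2)

/-- Compensation is an isometry of `L²(0, 1)`. -/
lemma integral_sq_compensated {g : ℝ → ℝ} (hg : Measurable g) (h2 : MemLp g 2 unif) :
    ∫ x, compensated g x ^ 2 ∂unif = ∫ x, g x ^ 2 ∂unif := by
  have hc := memLp_compensator hg h2
  have hgc : Integrable (fun x => g x * compensator g x) unif := h2.integrable_mul hc
  have e : ∀ x, compensated g x ^ 2 = g x ^ 2 - 2 * (g x * compensator g x) +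
      compensator g x ^ 2 := fun x => by rw [compensated]; ring
  simp only [e]
  have h1 : Integrable (fun x => g x ^ 2 - 2 * (g x * compensator g x)) unif :=
    h2.integrable_sq.sub (hgc.const_mul 2)
  rw [integral_add h1 hc.integrable_sq, integral_sub h2.integrable_sq (hgc.const_mul 2),
    integral_const_mul, integral_sq_compensator hg (h2.integrable one_le_two) hgc]
  ring

/-- The compensator of a function that is `p` up to `y` and `q` from there on. -/
lemma compensator_piecewise {p q : ℝ → ℝ} (hp : Integrable p unif) (hq : Integrable q unif)
    {x y : ℝ} (hyx : y ≤ x) (hx : x < 1) :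
    compensator (fun s => if s ≤ y then p s else q s) x =
      compensator q x - compensator q y + compensator p y := by
  have hy : y < 1 := hyx.trans_lt hx
  have ip := integrableOn_div_Iio hp hy
  have iq := integrableOn_div_Iio hq hx
  have iq' := integrableOn_div_Iio hq hy
  have e : (fun s => (if s ≤ y then p s else q s) / (1 - s)) =
      fun s => q s / (1 - s) +
        (Set.Iic y).indicator (fun s => p s / (1 - s) - q s / (1 - s)) s := by
    ext s; by_cases h : s ≤ y <;> simp [h]
  have iind : IntegrableOn ((Set.Iic y).indicator fun s => p s / (1 - s) - q s / (1 - s))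
      (Set.Iio x) unif := by
    refine IntegrableOn.integrable ?_
    refine Integrable.integrableOn ?_
    rw [integrable_indicator_iff measurableSet_Iic]
    exact (ip.sub iq').congr_set_ae Iio_ae_eq_Iic.symm
  have hset : (Set.Iio x ∩ Set.Iic y : Set ℝ) =ᵐ[unif] Set.Iio y := by
    rcases hyx.lt_or_eq with h | h
    · rw [Set.inter_eq_right.2 (Set.Iic_subset_Iio.2 h)]; exact Iio_ae_eq_Iic.symm
    · subst h; rw [Set.inter_eq_left.2 Set.Iio_subset_Iic_self]; exact Filter.EventuallyEq.rfl
  rw [compensator, e, integral_add iq iind, setIntegral_indicator measurableSet_Iic,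
    setIntegral_congr_set hset, integral_sub ip iq']
  simp only [compensator]
  ring

/-- Beyond `x`, the compensated function has the conditional mean that makes it a martingale. -/
lemma setIntegral_Ioi_compensated {q : ℝ → ℝ} (hq : Measurable q) (hi : Integrable q unif)
    {x : ℝ} (hx : x ∈ Set.Ioo (0 : ℝ) 1) :
    ∫ y in Set.Ioi x, compensated q y ∂unif = -((1 - x) * compensator q x) := by
  set q' : ℝ → ℝ := fun s => if s ≤ x then 0 else q s with hq'
  have e' : q' = (Set.Ioi x).indicator q := by
    ext s; by_cases h : s ≤ x
    · simp [hq', h]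
    · simp [hq', h, not_le.1 h]
  have hm : Measurable q' := e' ▸ hq.indicator measurableSet_Ioi
  have hi' : Integrable q' unif := e' ▸ hi.indicator measurableSet_Ioi
  have h := (integral_compensator hm hi').2
  have hc : compensator q' =ᵐ[unif]
      (Set.Ioi x).indicator fun y => compensator q y - compensator q x := by
    filter_upwards [ae_unif_mem] with y hy
    by_cases hxy : x < y
    · rw [Set.indicator_of_mem (Set.mem_Ioi.2 hxy), hq',
        compensator_piecewise (p := fun _ => 0) (by simp) hi hxy.le hy.2]
      simp [compensator]
    · rw [Set.indicator_of_notMem (by simpa using hxy),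
        compensator_congr (g' := fun _ => 0) fun s hs => ?_]
      · simp [compensator]
      · simp [hq', (hs.le.trans (not_lt.1 hxy))]
  have hci : IntegrableOn (compensator q) (Set.Ioi x) unif :=
    (integral_compensator hq hi).1.integrableOn
  rw [integral_congr_ae hc, integral_indicator measurableSet_Ioi, e',
    integral_indicator measurableSet_Ioi, integral_sub hci (integrable_const _),
    setIntegral_const, unif_real_Ioi hx, smul_eq_mul] at h
  have e2 : ∫ y in Set.Ioi x, compensated q y ∂unif =
    ∫ y in Set.Ioi x, q y ∂unif - ∫ y in Set.Ioi x, compensator q y ∂unif :=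
    integral_sub hi.integrableOn hci
  rw [e2]; linarith

/-- Orthogonality of the compensated contributions of two lifetimes `x` and `y`, when each of them
changes the integrand of the other from `p` to `q` after it has occurred. On `x < y` the inner
integral over `y` is `-(1 - x) H(x)` for the compensator `H` of `p`, and `∫ (p - H) H (1 - x) = 0`;
the other half follows by symmetry. -/
lemma integral_compensated_mul_compensated {p q : ℝ → ℝ} (hp : Measurable p) (hq : Measurable q)
    (hp2 : MemLp p 2 unif) (hq2 : MemLp q 2 unif) :
    ∫ y, ∫ x, compensated (fun s => if s ≤ y then p s else q s) x *
      compensated (fun s => if s ≤ x then p s else q s) y ∂unif ∂unif = 0 := by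
  have hpi := hp2.integrable one_le_two
  have hqi := hq2.integrable one_le_two
  have hcp := memLp_compensator hp hp2
  have hcq := memLp_compensator hq hq2
  set a := compensated p with ha
  have ha2 : MemLp a 2 unif := memLp_compensated hp hp2
  have haq2 : MemLp (compensated q) 2 unif := memLp_compensated hq hq2
  set d : ℝ → ℝ := fun x => compensator q x - compensator p x with hd
  have hd2 : MemLp d 2 unif := hcq.sub hcp
  set f : ℝ × ℝ → ℝ := fun z => a z.1 * (compensated q z.2 + d z.1) with hf
  have had : Integrable (fun x => a x * d x) unif := ha2.integrable_mul hd2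
  have hfi : Integrable f (unif.prod unif) := by
    have h1 := (ha2.integrable one_le_two).mul_prod (haq2.integrable one_le_two)
    have h2 := had.mul_prod (integrable_const (1 : ℝ) : Integrable (fun _ => (1 : ℝ)) unif)
    refine (h1.add h2).congr (ae_of_all _ fun z => ?_)
    simp [hf]; ring
  have hms : MeasurableSet {z : ℝ × ℝ | z.1 < z.2} := measurableSet_lt measurable_fst measurable_snd
  set F := Set.indicator {z : ℝ × ℝ | z.1 < z.2} f with hF
  have hFi : Integrable F (unif.prod unif) := hfi.indicator hms
  have hF0 : ∫ z, F z ∂(unif.prod unif) = 0 := by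
    rw [integral_prod _ hFi]
    have : (fun x => ∫ y, F (x, y) ∂unif) =ᵐ[unif]
        fun x => (1 - x) * compensator p x ^ 2 - (1 - x) * (p x * compensator p x) := by
      filter_upwards [ae_unif_mem] with x hx
      have e : (fun y => F (x, y)) = (Set.Ioi x).indicator fun y =>
          a x * (compensated q y + d x) := by
        ext y; simp [hF, hf, Set.indicator]
      rw [e, integral_indicator measurableSet_Ioi, integral_const_mul,
        integral_add (haq2.integrable one_le_two).integrableOn (integrable_const _),
        setIntegral_Ioi_compensated hq hqi hx, setIntegral_const, unif_real_Ioi hx, smul_eq_mul]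
      simp only [hd, ha, compensated]; ring
    have b1 : Integrable (fun x => p x * compensator p x) unif := hp2.integrable_mul hcp
    have hbdd : ∀ᵐ x ∂unif, ‖1 - x‖ ≤ 1 := by
      filter_upwards [ae_unif_mem] with x hx
      rw [Real.norm_eq_abs, abs_le]; constructor <;> linarith [hx.1, hx.2]
    have hm1 : AEStronglyMeasurable (fun x : ℝ => 1 - x) unif := by fun_prop
    rw [integral_congr_ae this, integral_sub (hcp.integrable_sq.bdd_mul hm1 hbdd)
      (b1.bdd_mul hm1 hbdd), integral_one_sub_mul_sq_compensator hp hpi b1, sub_self]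
  have hsum : ∫ z : ℝ × ℝ, F z + F z.swap ∂(unif.prod unif) = 0 := by
    have hFs : Integrable (fun z : ℝ × ℝ => F z.swap) (unif.prod unif) := hFi.swap
    rw [integral_add hFi hFs, integral_prod_swap, hF0, add_zero]
  have hdiag : ∀ᵐ z ∂(unif.prod unif), z.1 ≠ z.2 := by
    have : MeasurableSet {z : ℝ × ℝ | z.1 ≠ z.2} :=
      (measurableSet_eq_fun measurable_fst measurable_snd).compl
    rw [Measure.ae_prod_iff_ae_ae this]
    refine ae_of_all _ fun s => ?_
    have : ∀ᵐ t ∂unif, t ≠ s := by simp [ae_iff]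
    filter_upwards [this] with t ht using ht.symm
  have hm : ∀ᵐ z ∂(unif.prod unif), z.1 < 1 ∧ z.2 < 1 := by
    have : MeasurableSet {z : ℝ × ℝ | z.1 < 1 ∧ z.2 < 1} :=
      (measurableSet_lt measurable_fst measurable_const).inter
        (measurableSet_lt measurable_snd measurable_const)
    rw [Measure.ae_prod_iff_ae_ae this]
    filter_upwards [ae_unif_mem] with s hs
    filter_upwards [ae_unif_mem] with t ht using ⟨hs.2, ht.2⟩
  -- the two factors, for the lifetime that comes first and for the one that comes second
  have first : ∀ x y : ℝ, x < y →
      compensated (fun s => if s ≤ y then p s else q s) x = a x := by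
    intro x y h
    rw [ha, compensated, compensated, if_pos h.le,
      compensator_congr (g' := p) fun s hs => if_pos (hs.trans h).le]
  have second : ∀ x y : ℝ, x < y → y < 1 →
      compensated (fun s => if s ≤ x then p s else q s) y = compensated q y + d x := by
    intro x y h hy
    rw [compensated, compensated, if_neg (not_le.2 h), compensator_piecewise hpi hqi h.le hy, hd]
    ring
  have hcongr : (fun z : ℝ × ℝ => F z + F z.swap) =ᵐ[unif.prod unif] fun z =>
      compensated (fun s => if s ≤ z.2 then p s else q s) z.1 *
      compensated (fun s => if s ≤ z.1 then p s else q s) z.2 := by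
    filter_upwards [hdiag, hm] with z hz hz1
    rcases lt_or_gt_of_ne hz with h | h
    · simp [hF, hf, h, h.not_gt, first _ _ h, second _ _ h hz1.2]
    · simp [hF, hf, h, h.not_gt, first _ _ h, second _ _ h hz1.1, mul_comm]
  have hFs : Integrable (fun z : ℝ × ℝ => F z.swap) (unif.prod unif) := hFi.swap
  rw [integral_congr_ae hcongr, integral_prod_symm _ ((hFi.add hFs).congr hcongr)] at hsum
  exact hsum

/-! ### Independent uniform variables observed up to an order statistic -/

/-- The joint law of `n` independent uniform variables. -/
def unifSample (n : ℕ) : Measure (Fin n → ℝ) := Measure.pi fun _ => unif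

instance (n : ℕ) : IsProbabilityMeasure (unifSample n) := by unfold unifSample; infer_instance

/-- The number of variables other than the `i`-th that are smaller than `s`. -/
def numBefore {n : ℕ} (i : Fin n) (v : Fin n → ℝ) (s : ℝ) : ℕ :=
  (Finset.univ.filter fun j => j ≠ i ∧ v j < s).card

/-- The indicator that fewer than `r` of the variables other than the `i`-th are smaller than `s`:
for `s ≤ v i` this says that observation has not stopped before `s`. -/
def observed {n : ℕ} (r : ℕ) (i : Fin n) (v : Fin n → ℝ) (s : ℝ) : ℝ :=
  if numBefore i v s < r then 1 else 0

/-- The contribution of the `i`-th variable to the compensated sum of `ρ` over the observation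
period. -/
def contribution {n : ℕ} (r : ℕ) (ρ : ℝ → ℝ) (i : Fin n) (v : Fin n → ℝ) : ℝ :=
  compensated (fun s => ρ s * observed r i v s) (v i)

lemma observed_mem {n : ℕ} (r : ℕ) (i : Fin n) (v : Fin n → ℝ) (s : ℝ) :
    observed r i v s = 0 ∨ observed r i v s = 1 := by unfold observed; split_ifs <;> simp

lemma measurable_numBefore {n : ℕ} (i : Fin n) :
    Measurable fun z : (Fin n → ℝ) × ℝ => numBefore i z.1 z.2 := by
  simp only [numBefore, Finset.card_filter]
  refine Finset.measurable_sum _ fun j _ => Measurable.ite ?_ measurable_const measurable_const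
  exact (MeasurableSet.const _).inter
    (measurableSet_lt ((measurable_pi_apply j).comp measurable_fst) measurable_snd)

lemma measurable_observed {n : ℕ} (r : ℕ) (i : Fin n) :
    Measurable fun z : (Fin n → ℝ) × ℝ => observed r i z.1 z.2 :=
  Measurable.ite (measurableSet_lt (measurable_numBefore i) measurable_const)
    measurable_const measurable_const

lemma measurable_mul_observed {n : ℕ} (r : ℕ) {ρ : ℝ → ℝ} (hρ : Measurable ρ) (i : Fin n)
    (v : Fin n → ℝ) : Measurable fun s => ρ s * observed r i v s :=
  hρ.mul ((measurable_observed r i).comp measurable_prodMk_left)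

lemma abs_mul_observed_le {n : ℕ} (r : ℕ) (ρ : ℝ → ℝ) (i : Fin n)
    (v : Fin n → ℝ) (s : ℝ) : |ρ s * observed r i v s| ≤ |ρ s| := by
  rcases observed_mem r i v s with h | h <;> simp [h]

lemma memLp_mul_observed {n : ℕ} (r : ℕ) {ρ : ℝ → ℝ} (hρ : Measurable ρ) (h2 : MemLp ρ 2 unif)
    (i : Fin n) (v : Fin n → ℝ) : MemLp (fun s => ρ s * observed r i v s) 2 unif :=
  h2.mono (measurable_mul_observed r hρ i v).aestronglyMeasurable
    (ae_of_all _ fun s => by simpa using abs_mul_observed_le r ρ i v s)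

lemma measurable_contribution {n : ℕ} (r : ℕ) {ρ : ℝ → ℝ} (hρ : Measurable ρ) (i : Fin n) :
    Measurable (contribution r ρ i) := by
  have hid : Measurable fun v : Fin n → ℝ => v i := measurable_pi_apply i
  have h1 : Measurable fun v : Fin n → ℝ => ρ (v i) * observed r i v (v i) :=
    (hρ.comp hid).mul ((measurable_observed r i).comp (measurable_id.prodMk hid))
  refine h1.sub ?_
  have h2 : StronglyMeasurable (Function.uncurry fun (v : Fin n → ℝ) (s : ℝ) =>
      (Set.Iio (v i)).indicator (fun s => ρ s * observed r i v s / (1 - s)) s) := by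
    apply Measurable.stronglyMeasurable
    have : (Function.uncurry fun (v : Fin n → ℝ) (s : ℝ) =>
        (Set.Iio (v i)).indicator (fun s => ρ s * observed r i v s / (1 - s)) s) =
        Set.indicator {z : (Fin n → ℝ) × ℝ | z.2 < z.1 i}
          (fun z => ρ z.2 * observed r i z.1 z.2 / (1 - z.2)) := by
      ext ⟨x, s⟩; simp [Set.indicator]
    rw [this]
    exact (((hρ.comp measurable_snd).mul (measurable_observed r i)).div
      (measurable_const.sub measurable_snd)).indicator
      (measurableSet_lt measurable_snd (hid.comp measurable_fst))
  have := (h2.integral_prod_right (ν := unif)).measurable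
  simpa only [integral_indicator measurableSet_Iio, compensator] using this

lemma ae_unifSample_mem (n : ℕ) : ∀ᵐ v ∂unifSample n, ∀ i, v i ∈ Set.Ioo (0 : ℝ) 1 :=
  ae_all_iff.2 fun i => (measurePreserving_eval (fun _ => unif) i).quasiMeasurePreserving.ae
    ae_unif_mem

lemma memLp_contribution {n : ℕ} (r : ℕ) {ρ : ℝ → ℝ} (hρ : Measurable ρ) (h2 : MemLp ρ 2 unif)
    (i : Fin n) : MemLp (contribution r ρ i) 2 (unifSample n) := by
  have hM : MemLp (fun x => |ρ x| + compensator (fun s => |ρ s|) x) 2 unif :=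
    h2.abs.add (memLp_compensator_abs hρ h2)
  refine (hM.comp_measurePreserving (measurePreserving_eval (fun _ : Fin n => unif) i)).mono'
    (measurable_contribution r hρ i).aestronglyMeasurable ?_
  filter_upwards [ae_unifSample_mem n] with v hv
  refine (abs_sub _ _).trans (add_le_add (abs_mul_observed_le r ρ i v _) ?_)
  exact abs_compensator_le (h2.integrable one_le_two).abs (abs_mul_observed_le r ρ i v) (hv i).2

/-- Resampling one of the variables does not change the joint law. -/
lemma measurePreserving_update_unifSample {n : ℕ} (i : Fin n) :
    MeasurePreserving (fun z : (Fin n → ℝ) × ℝ => Function.update z.1 i z.2)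
      ((unifSample n).prod unif) (unifSample n) := by
  refine ⟨measurable_update', ?_⟩
  refine (Measure.pi_eq fun s hs => ?_).symm
  have hpre : (fun z : (Fin n → ℝ) × ℝ => Function.update z.1 i z.2) ⁻¹' Set.univ.pi s =
      (Set.univ.pi (Function.update s i Set.univ)) ×ˢ s i := by
    ext ⟨v, x⟩
    simp only [Set.mem_preimage, Set.mem_pi, Set.mem_univ, true_imp_iff, Set.mem_prod]
    constructor
    · refine fun h => ⟨fun j => ?_, by simpa using h i⟩
      by_cases hj : j = i
      · subst hj; simp
      · simpa [hj] using h j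
    · rintro ⟨h1, h2⟩ j
      by_cases hj : j = i
      · subst hj; simpa using h2
      · simpa [hj] using h1 j
  rw [Measure.map_apply measurable_update' (MeasurableSet.univ_pi hs), hpre, Measure.prod_prod,
    unifSample, Measure.pi_pi, Fintype.prod_eq_mul_prod_compl i,
    Fintype.prod_eq_mul_prod_compl i (fun j => unif (s j))]
  simp only [Function.update_self, measure_univ, one_mul]
  rw [mul_comm]
  congr 1
  refine Finset.prod_congr rfl fun j hj => ?_
  rw [Function.update_of_ne (by simpa using hj)]

lemma integral_update_unifSample {n : ℕ} (i : Fin n) {f : (Fin n → ℝ) → ℝ}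
    (hf : Integrable f (unifSample n)) :
    Integrable (fun v => ∫ x, f (Function.update v i x) ∂unif) (unifSample n) ∧
    ∫ v, f v ∂unifSample n = ∫ v, ∫ x, f (Function.update v i x) ∂unif ∂unifSample n := by
  have hmp := measurePreserving_update_unifSample i
  have hi : Integrable (fun z : (Fin n → ℝ) × ℝ => f (Function.update z.1 i z.2))
      ((unifSample n).prod unif) := hmp.integrable_comp_of_integrable hf
  refine ⟨hi.integral_prod_left, ?_⟩
  rw [← integral_prod _ hi]
  conv_lhs => rw [← hmp.map_eq]
  exact integral_map hmp.measurable.aemeasurable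
    (by rw [hmp.map_eq]; exact hf.aestronglyMeasurable)

lemma numBefore_update_self {n : ℕ} (i : Fin n) (v : Fin n → ℝ) (x s : ℝ) :
    numBefore i (Function.update v i x) s = numBefore i v s := by
  unfold numBefore
  congr 1
  ext j
  by_cases hj : j = i <;> simp [hj]

lemma observed_update_self {n : ℕ} (r : ℕ) (i : Fin n) (v : Fin n → ℝ) (x : ℝ) :
    observed r i (Function.update v i x) = observed r i v := by
  ext s; rw [observed, observed, numBefore_update_self]

/-- The probability that fewer than `r` of the variables other than the `i`-th are below `x`. -/
def observedProb {n : ℕ} (r : ℕ) (i : Fin n) (x : ℝ) : ℝ :=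
  ∫ v, observed r i v x ∂unifSample n

lemma integral_sq_contribution {n : ℕ} (r : ℕ) {ρ : ℝ → ℝ} (hρ : Measurable ρ)
    (h2 : MemLp ρ 2 unif) (i : Fin n) :
    ∫ v, contribution r ρ i v ^ 2 ∂unifSample n = ∫ x, ρ x ^ 2 * observedProb r i x ∂unif := by
  rw [(integral_update_unifSample i (memLp_contribution r hρ h2 i).integrable_sq).2]
  have e : ∀ v, ∫ x, contribution r ρ i (Function.update v i x) ^ 2 ∂unif =
      ∫ x, ρ x ^ 2 * observed r i v x ∂unif := by
    intro v
    simp only [contribution, observed_update_self, Function.update_self]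
    rw [integral_sq_compensated (measurable_mul_observed r hρ i v)
      (memLp_mul_observed r hρ h2 i v)]
    refine integral_congr_ae (ae_of_all _ fun x => ?_)
    rcases observed_mem r i v x with h | h <;> simp [h]
  simp only [e]
  have hsq : Integrable (fun z : (Fin n → ℝ) × ℝ => ρ z.2 ^ 2) ((unifSample n).prod unif) :=
    h2.integrable_sq.comp_snd _
  rw [integral_integral_swap]
  · simp only [integral_const_mul, observedProb]
  · refine hsq.mono' (((hρ.comp measurable_snd).pow_const 2).mul
      (measurable_observed r i)).aestronglyMeasurable (ae_of_all _ fun z => ?_)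
    rcases observed_mem r i z.1 z.2 with h | h <;> simp [Function.uncurry, h, sq_nonneg]

/-- The number of variables other than the `i`-th and `j`-th that are smaller than `s`. -/
def numBefore₂ {n : ℕ} (i j : Fin n) (v : Fin n → ℝ) (s : ℝ) : ℕ :=
  (Finset.univ.filter fun k => k ≠ i ∧ k ≠ j ∧ v k < s).card

lemma numBefore_eq_numBefore₂ {n : ℕ} {i j : Fin n} (hij : i ≠ j) (v : Fin n → ℝ) (s : ℝ) :
    numBefore i v s = numBefore₂ i j v s + if s ≤ v j then 0 else 1 := by
  unfold numBefore numBefore₂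
  split_ifs with h
  · rw [add_zero]
    congr 1
    ext k
    simp only [Finset.mem_filter, Finset.mem_univ, true_and]
    refine ⟨fun hk => ⟨hk.1, ?_, hk.2⟩, fun hk => ⟨hk.1, hk.2.2⟩⟩
    rintro rfl
    exact not_lt.2 h hk.2
  · rw [← Finset.card_insert_of_notMem (a := j) (by simp)]
    congr 1
    ext k
    simp only [Finset.mem_filter, Finset.mem_univ, true_and, Finset.mem_insert]
    by_cases hk : k = j
    · subst hk; simp [hij.symm, not_le.1 h]
    · simp [hk]

lemma numBefore₂_comm {n : ℕ} (i j : Fin n) (v : Fin n → ℝ) (s : ℝ) :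
    numBefore₂ i j v s = numBefore₂ j i v s := by
  unfold numBefore₂
  congr 1; ext k; simp only [Finset.mem_filter]; tauto

lemma numBefore₂_update {n : ℕ} (i j : Fin n) (v : Fin n → ℝ) (x y s : ℝ) :
    numBefore₂ i j (Function.update (Function.update v j y) i x) s = numBefore₂ i j v s := by
  unfold numBefore₂
  congr 1; ext k
  by_cases hi : k = i
  · simp [hi]
  · by_cases hj : k = j <;> simp [hi, hj]

/-- The contributions of different variables are orthogonal: with all other variables fixed,
the two integrands are of the form treated in `integral_compensated_mul_compensated`. -/
lemma integral_contribution_mul_contribution {n : ℕ} (r : ℕ) {ρ : ℝ → ℝ} (hρ : Measurable ρ)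
    (h2 : MemLp ρ 2 unif) {i j : Fin n} (hij : i ≠ j) :
    ∫ v, contribution r ρ i v * contribution r ρ j v ∂unifSample n = 0 := by
  have hint : Integrable (fun v => contribution r ρ i v * contribution r ρ j v) (unifSample n) :=
    (memLp_contribution r hρ h2 i).integrable_mul (memLp_contribution r hρ h2 j)
  have h1 := integral_update_unifSample i hint
  rw [h1.2, (integral_update_unifSample j h1.1).2]
  refine integral_eq_zero_of_ae (ae_of_all _ fun v => ?_)
  set p : ℝ → ℝ := fun s => ρ s * if numBefore₂ i j v s < r then 1 else 0 with hp
  set q : ℝ → ℝ := fun s => ρ s * if numBefore₂ i j v s + 1 < r then 1 else 0 with hq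
  have hN : Measurable fun s => numBefore₂ i j v s := by
    simp only [numBefore₂, Finset.card_filter]
    refine Finset.measurable_sum _ fun k _ => Measurable.ite ?_ measurable_const measurable_const
    exact (MeasurableSet.const _).inter ((MeasurableSet.const _).inter measurableSet_Ioi)
  have hpm : Measurable p := hρ.mul (Measurable.ite (measurableSet_lt hN measurable_const)
    measurable_const measurable_const)
  have hqm : Measurable q := hρ.mul (Measurable.ite
    (measurableSet_lt (hN.add_const 1) measurable_const) measurable_const measurable_const)
  have hp2 : MemLp p 2 unif := h2.mono hpm.aestronglyMeasurable (ae_of_all _ fun s => by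
    simp only [hp]; split_ifs <;> simp)
  have hq2 : MemLp q 2 unif := h2.mono hqm.aestronglyMeasurable (ae_of_all _ fun s => by
    simp only [hq]; split_ifs <;> simp)
  have e1 : ∀ x y s, ρ s * observed r i (Function.update (Function.update v j y) i x) s =
      if s ≤ y then p s else q s := by
    intro x y s
    rw [observed, numBefore_eq_numBefore₂ hij, numBefore₂_update,
      Function.update_of_ne hij.symm, Function.update_self]
    by_cases h : s ≤ y <;> simp [h, hp, hq]
  have e2 : ∀ x y s, ρ s * observed r j (Function.update (Function.update v j y) i x) s =
      if s ≤ x then p s else q s := by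
    intro x y s
    rw [observed, numBefore_eq_numBefore₂ hij.symm, numBefore₂_comm, numBefore₂_update,
      Function.update_self]
    by_cases h : s ≤ x <;> simp [h, hp, hq]
  have := integral_compensated_mul_compensated hpm hqm hp2 hq2
  simpa only [contribution, e1, e2, Function.update_self, Function.update_of_ne hij.symm,
    Pi.zero_apply] using this

/-- The compensated sum of `ρ` over the observation period. -/
def totalContribution (n r : ℕ) (ρ : ℝ → ℝ) (v : Fin n → ℝ) : ℝ := ∑ i, contribution r ρ i v

lemma memLp_totalContribution (n r : ℕ) {ρ : ℝ → ℝ} (hρ : Measurable ρ) (h2 : MemLp ρ 2 unif) :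
    MemLp (totalContribution n r ρ) 2 (unifSample n) :=
  memLp_finsetSum _ fun i _ => memLp_contribution r hρ h2 i

lemma integral_sq_totalContribution (n r : ℕ) {ρ : ℝ → ℝ} (hρ : Measurable ρ)
    (h2 : MemLp ρ 2 unif) :
    ∫ v, totalContribution n r ρ v ^ 2 ∂unifSample n =
      ∑ i : Fin n, ∫ x, ρ x ^ 2 * observedProb r i x ∂unif := by
  have hint : ∀ i j : Fin n,
      Integrable (fun v => contribution r ρ i v * contribution r ρ j v) (unifSample n) := fun i j =>
    (memLp_contribution r hρ h2 i).integrable_mul (memLp_contribution r hρ h2 j)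
  simp only [totalContribution, sq (∑ i : Fin n, _), Finset.sum_mul_sum]
  rw [integral_finsetSum _ fun i _ => integrable_finsetSum _ fun j _ => hint i j]
  refine Finset.sum_congr rfl fun i _ => ?_
  rw [integral_finsetSum _ fun j _ => hint i j, Finset.sum_eq_single i]
  · rw [← integral_sq_contribution r hρ h2]; simp only [sq]
  · exact fun j _ hj => integral_contribution_mul_contribution r hρ h2 hj.symm
  · simp

lemma totalContribution_add (n r : ℕ) {ρ τ : ℝ → ℝ} (hρ : Measurable ρ) (hτ : Measurable τ)
    (h2 : MemLp ρ 2 unif) (h2' : MemLp τ 2 unif) {v : Fin n → ℝ} (hv : ∀ i, v i < 1) :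
    totalContribution n r (fun s => ρ s + τ s) v =
      totalContribution n r ρ v + totalContribution n r τ v := by
  simp only [totalContribution]
  rw [← Finset.sum_add_distrib]
  refine Finset.sum_congr rfl fun i _ => ?_
  have hi := integrableOn_div_Iio ((memLp_mul_observed r hρ h2 i v).integrable one_le_two) (hv i)
  have hi' := integrableOn_div_Iio ((memLp_mul_observed r hτ h2' i v).integrable one_le_two) (hv i)
  simp only [contribution, compensated, compensator, add_mul, add_div]
  rw [integral_add hi hi']; ring

/-- The product moment of two compensated sums, by polarization. -/
lemma integral_totalContribution_mul (n r : ℕ) {ρ τ : ℝ → ℝ} (hρ : Measurable ρ)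
    (hτ : Measurable τ) (h2 : MemLp ρ 2 unif) (h2' : MemLp τ 2 unif) :
    ∫ v, totalContribution n r ρ v * totalContribution n r τ v ∂unifSample n =
      ∑ i : Fin n, ∫ x, ρ x * τ x * observedProb r i x ∂unif := by
  have hs := integral_sq_totalContribution n r (hρ.add hτ) (h2.add h2')
  have e : (fun v => totalContribution n r (ρ + τ) v ^ 2) =ᵐ[unifSample n] fun v =>
      totalContribution n r ρ v ^ 2 +
      2 * (totalContribution n r ρ v * totalContribution n r τ v) +
      totalContribution n r τ v ^ 2 := by
    filter_upwards [ae_unifSample_mem n] with v hv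
    have := totalContribution_add n r hρ hτ h2 h2' fun i => (hv i).2
    rw [show ρ + τ = fun s => ρ s + τ s from rfl, this]; ring
  have m1 := memLp_totalContribution n r hρ h2
  have m2 := memLp_totalContribution n r hτ h2'
  have i12 : Integrable (fun v => totalContribution n r ρ v * totalContribution n r τ v)
      (unifSample n) := m1.integrable_mul m2
  have iA : Integrable (fun v => totalContribution n r ρ v ^ 2 +
      2 * (totalContribution n r ρ v * totalContribution n r τ v)) (unifSample n) :=
    m1.integrable_sq.add (i12.const_mul 2)
  rw [integral_congr_ae e, integral_add iA m2.integrable_sq,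
    integral_add m1.integrable_sq (i12.const_mul 2), integral_const_mul,
    integral_sq_totalContribution n r hρ h2, integral_sq_totalContribution n r hτ h2'] at hs
  have hP : ∀ i : Fin n, ∀ {f : ℝ → ℝ}, Integrable f unif →
      Integrable (fun x => f x * observedProb r i x) unif := by
    intro i f hf
    refine hf.mul_bdd (c := 1) ?_ (ae_of_all _ fun x => ?_)
    · exact ((measurable_observed r i).stronglyMeasurable.integral_prod_left
        (μ := unifSample n) (f := fun v x => observed r i v x)).aestronglyMeasurable
    · refine (norm_integral_le_of_norm_le_const (C := 1) (ae_of_all _ fun v => ?_)).trans (by simp)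
      rcases observed_mem r i v x with h | h <;> simp [h]
  have iρτ : Integrable (fun x => ρ x * τ x) unif := h2.integrable_mul h2'
  have e2 : ∀ i : Fin n, ∫ x, (ρ + τ) x ^ 2 * observedProb r i x ∂unif =
      ∫ x, ρ x ^ 2 * observedProb r i x ∂unif + 2 * ∫ x, ρ x * τ x * observedProb r i x ∂unif +
      ∫ x, τ x ^ 2 * observedProb r i x ∂unif := by
    intro i
    have iB : Integrable (fun x => ρ x ^ 2 * observedProb r i x +
        2 * (ρ x * τ x * observedProb r i x)) unif :=
      (hP i h2.integrable_sq).add ((hP i iρτ).const_mul 2)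
    rw [← integral_const_mul, ← integral_add (hP i h2.integrable_sq) ((hP i iρτ).const_mul 2),
      ← integral_add iB (hP i h2'.integrable_sq)]
    refine integral_congr_ae (ae_of_all _ fun x => ?_)
    simp only [Pi.add_apply]; ring
  simp only [e2, Finset.sum_add_distrib, ← Finset.mul_sum] at hs
  linarith

/-! ### The limiting observed fraction -/

lemma observedProb_eq_measureReal {n : ℕ} (r : ℕ) (i : Fin n) (x : ℝ) :
    observedProb r i x = (unifSample n).real {v | numBefore i v x < r} := by
  have hm : MeasurableSet {v : Fin n → ℝ | numBefore i v x < r} :=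
    measurableSet_lt ((measurable_numBefore i).comp measurable_prodMk_right) measurable_const
  rw [observedProb, ← integral_indicator_one hm]
  refine integral_congr_ae (ae_of_all _ fun v => ?_)
  simp [observed, Set.indicator]

/-- Chebyshev's inequality for the binomial variable `numBefore`. -/
lemma measureReal_numBefore_deviation {n : ℕ} (i : Fin n) {x c : ℝ}
    (hx : x ∈ Set.Ioo (0 : ℝ) 1) (hc : 0 < c) :
    (unifSample n).real {v | c ≤ |(numBefore i v x : ℝ) - (n - 1) * x|} ≤ n / c ^ 2 := by
  set X : Fin n → (Fin n → ℝ) → ℝ := fun j v => (Set.Iio x).indicator (fun _ => (1 : ℝ)) (v j)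
    with hX
  have hg : Measurable ((Set.Iio x).indicator fun _ : ℝ => (1 : ℝ)) :=
    measurable_const.indicator measurableSet_Iio
  have hmX : ∀ j, Measurable (X j) := fun j => hg.comp (measurable_pi_apply j)
  have hbX : ∀ j v, X j v ∈ Set.Icc (0 : ℝ) 1 := by
    intro j v
    simp only [hX, Set.indicator]; split_ifs <;> simp
  have hX2 : ∀ j, MemLp (X j) 2 (unifSample n) := fun j =>
    MemLp.of_bound (hmX j).aestronglyMeasurable 1 (ae_of_all _ fun v => by
      rw [Real.norm_of_nonneg (hbX j v).1]; exact (hbX j v).2)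
  have hEX : ∀ j, ∫ v, X j v ∂unifSample n = x := by
    intro j
    have hmp := measurePreserving_eval (fun _ : Fin n => unif) j
    have : ∫ v, X j v ∂unifSample n = ∫ y, (Set.Iio x).indicator (fun _ => (1 : ℝ)) y ∂unif := by
      conv_rhs => rw [← hmp.map_eq]
      exact (integral_map hmp.measurable.aemeasurable hg.aestronglyMeasurable).symm
    rw [this, integral_indicator measurableSet_Iio, setIntegral_const, unif_real_Iio hx]
    simp
  have hind : ProbabilityTheory.iIndepFun X (unifSample n) :=
    ProbabilityTheory.iIndepFun_pi (μ := fun _ : Fin n => unif)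
      (X := fun _ => (Set.Iio x).indicator fun _ => (1 : ℝ)) fun _ => hg.aemeasurable
  set Y := ∑ j ∈ Finset.univ.erase i, X j with hY
  have hYe : ∀ v, (numBefore i v x : ℝ) = Y v := by
    intro v
    rw [numBefore, Finset.card_filter, hY, Finset.sum_apply,
      ← Finset.sum_erase (a := i) Finset.univ (by simp)]
    push_cast
    refine Finset.sum_congr rfl fun j hj => ?_
    simp [hX, Set.indicator, Finset.ne_of_mem_erase hj]
  have hY2 : MemLp Y 2 (unifSample n) := memLp_finsetSum' _ fun j _ => hX2 j
  have hEY : ∫ v, Y v ∂unifSample n = (n - 1) * x := by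
    simp only [hY, Finset.sum_apply]
    rw [integral_finsetSum _ fun j _ => (hX2 j).integrable one_le_two]
    simp only [hEX, Finset.sum_const, nsmul_eq_mul]
    rw [Finset.card_erase_of_mem (Finset.mem_univ _), Finset.card_univ, Fintype.card_fin,
      Nat.cast_sub (by have := i.isLt; omega)]
    simp
  have hvar : ProbabilityTheory.variance Y (unifSample n) ≤ n := by
    rw [hY, ProbabilityTheory.IndepFun.variance_sum (fun j _ => hX2 j)
      fun j _ k _ hjk => hind.indepFun hjk]
    calc ∑ j ∈ Finset.univ.erase i, ProbabilityTheory.variance (X j) (unifSample n)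
        ≤ ∑ j ∈ Finset.univ.erase i, (1 : ℝ) := by
          refine Finset.sum_le_sum fun j _ => ?_
          refine (ProbabilityTheory.variance_le_sq_of_bounded
            (ae_of_all _ (hbX j)) (hmX j).aemeasurable).trans ?_
          norm_num
      _ ≤ ∑ j : Fin n, (1 : ℝ) :=
          Finset.sum_le_sum_of_subset_of_nonneg (Finset.subset_univ _) fun _ _ _ => zero_le_one
      _ = n := by simp
  have hcheb := ProbabilityTheory.meas_ge_le_variance_div_sq hY2 hc
  rw [hEY] at hcheb
  simp only [hYe]
  refine (ENNReal.toReal_le_of_le_ofReal (by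
    have := ProbabilityTheory.variance_nonneg Y (unifSample n)
    positivity) hcheb).trans ?_
  gcongr

/-- If `r n / n → p`, the probability that a variable is still under observation at `x` tends to
`1` for `x < p` and to `0` for `x > p`, on average over the variables. -/
lemma tendsto_average_observedProb {r : ℕ → ℕ} {p : ℝ}
    (hr : Tendsto (fun n : ℕ => (r n : ℝ) / n) atTop (𝓝 p)) {x : ℝ} (hx : x ∈ Set.Ioo (0 : ℝ) 1)
    (hxp : x ≠ p) :
    Tendsto (fun n : ℕ => (n : ℝ)⁻¹ * ∑ i : Fin n, observedProb (r n) i x) atTop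
      (𝓝 ((Set.Iio p).indicator (fun _ => 1) x)) := by
  set L : ℝ := (Set.Iio p).indicator (fun _ => 1) x with hL
  set δ : ℝ := |x - p| / 3 with hδ
  have hδ0 : 0 < δ := div_pos (abs_pos.2 (sub_ne_zero.2 hxp)) (by norm_num)
  have hbound : ∀ᶠ n : ℕ in atTop, ∀ i : Fin n,
      |observedProb (r n) i x - L| ≤ n / ((n : ℝ) * δ) ^ 2 := by
    have hlarge : ∀ᶠ n : ℕ in atTop, 1 / δ < (n : ℝ) :=
      tendsto_natCast_atTop_atTop.eventually_gt_atTop _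
    have hclose : ∀ᶠ n : ℕ in atTop, |(r n : ℝ) / n - p| < δ := by
      have := (tendsto_order.1 (tendsto_iff_dist_tendsto_zero.1 hr)).2 δ hδ0
      simpa [Real.dist_eq] using this
    filter_upwards [hlarge, hclose] with n hn hrn i
    have hnpos : (0 : ℝ) < n := lt_trans (by positivity) hn
    have h1n : 1 < n * δ := by rwa [div_lt_iff₀ hδ0] at hn
    have hdev := measureReal_numBefore_deviation i hx (c := n * δ) (by positivity)
    rw [abs_lt] at hrn
    have hr1 : (r n : ℝ) < n * p + n * δ := by
      have : (r n : ℝ) / n < p + δ := by linarith [hrn.2]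
      rw [div_lt_iff₀ hnpos] at this; linarith
    have hr2 : n * p - n * δ < (r n : ℝ) := by
      have : p - δ < (r n : ℝ) / n := by linarith [hrn.1]
      rw [lt_div_iff₀ hnpos] at this; linarith
    have hm : MeasurableSet {v : Fin n → ℝ | numBefore i v x < r n} :=
      measurableSet_lt ((measurable_numBefore i).comp measurable_prodMk_right) measurable_const
    rw [observedProb_eq_measureReal]
    rcases lt_or_gt_of_ne hxp with h | h
    · have hpx : n * p = n * x + 3 * (n * δ) := by
        rw [hδ, abs_of_neg (by linarith)]; ring
      rw [hL, Set.indicator_of_mem (Set.mem_Iio.2 h), abs_sub_comm, ← probReal_compl_eq_one_sub hm,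
        abs_of_nonneg measureReal_nonneg]
      refine (measureReal_mono fun v hv => ?_).trans hdev
      have hv' : (r n : ℝ) ≤ numBefore i v x := by
        simpa using hv
      have : n * δ ≤ (numBefore i v x : ℝ) - (n - 1) * x := by linarith [hx.1]
      exact this.trans (le_abs_self _)
    · have hpx : n * x = n * p + 3 * (n * δ) := by
        rw [hδ, abs_of_pos (by linarith)]; ring
      rw [hL, Set.indicator_of_notMem (by simpa using h.le), sub_zero,
        abs_of_nonneg measureReal_nonneg]
      refine (measureReal_mono fun v hv => ?_).trans hdev
      have hv' : (numBefore i v x : ℝ) < r n := by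
        have : numBefore i v x < r n := hv
        exact_mod_cast this
      have : n * δ ≤ -((numBefore i v x : ℝ) - (n - 1) * x) := by linarith [hx.2]
      exact this.trans (neg_le_abs _)
  rw [tendsto_iff_dist_tendsto_zero]
  have hz : Tendsto (fun n : ℕ => 1 / δ ^ 2 * (n : ℝ)⁻¹) atTop (𝓝 0) := by
    simpa only [mul_zero] using (tendsto_inv_atTop_nhds_zero_nat (𝕜 := ℝ)).const_mul (1 / δ ^ 2)
  refine squeeze_zero' (Eventually.of_forall fun _ => dist_nonneg) ?_ hz
  filter_upwards [hbound, eventually_gt_atTop 0] with n hn hn0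
  have hnpos : (0 : ℝ) < n := by exact_mod_cast hn0
  have e : (n : ℝ)⁻¹ * ∑ i : Fin n, observedProb (r n) i x - L =
      (n : ℝ)⁻¹ * ∑ i : Fin n, (observedProb (r n) i x - L) := by
    rw [Finset.sum_sub_distrib, mul_sub]; simp; field_simp
  rw [Real.dist_eq, e, abs_mul, abs_of_pos (inv_pos.2 hnpos)]
  calc (n : ℝ)⁻¹ * |∑ i : Fin n, (observedProb (r n) i x - L)|
      ≤ (n : ℝ)⁻¹ * ∑ i : Fin n, (n / ((n : ℝ) * δ) ^ 2) := by
        gcongr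
        exact (Finset.abs_sum_le_sum_abs _ _).trans (Finset.sum_le_sum fun i _ => hn i)
    _ = 1 / δ ^ 2 * (n : ℝ)⁻¹ := by
        simp; field_simp

/-- The product moments of the compensated sums, divided by `n`, converge to `∫₀ᵖ ρ τ`. -/
lemma tendsto_integral_totalContribution_mul {r : ℕ → ℕ} {p : ℝ} (hp : p ∈ Set.Ioo (0 : ℝ) 1)
    (hr : Tendsto (fun n : ℕ => (r n : ℝ) / n) atTop (𝓝 p)) {ρ τ : ℝ → ℝ} (hρ : Measurable ρ)
    (hτ : Measurable τ) (h2 : MemLp ρ 2 unif) (h2' : MemLp τ 2 unif) :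
    Tendsto (fun n : ℕ => (n : ℝ)⁻¹ *
      ∫ v, totalContribution n (r n) ρ v * totalContribution n (r n) τ v ∂unifSample n) atTop
      (𝓝 (∫ x in (0 : ℝ)..p, ρ x * τ x)) := by
  have iρτ : Integrable (fun x => ρ x * τ x) unif := h2.integrable_mul h2'
  have hPm : ∀ n r (i : Fin n), StronglyMeasurable fun x => observedProb r i x := fun n r i =>
    (measurable_observed r i).stronglyMeasurable.integral_prod_left
        (μ := unifSample n) (f := fun v x => observed r i v x)
  have hP0 : ∀ n r (i : Fin n) x, observedProb r i x ∈ Set.Icc (0 : ℝ) 1 := by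
    intro n r i x
    rw [observedProb_eq_measureReal]
    exact ⟨measureReal_nonneg, measureReal_le_one⟩
  have hPi : ∀ n r (i : Fin n), Integrable (fun x => ρ x * τ x * observedProb r i x) unif := by
    intro n r i
    refine iρτ.mul_bdd (c := 1) (hPm n r i).aestronglyMeasurable (ae_of_all _ fun x => ?_)
    rw [Real.norm_of_nonneg (hP0 n r i x).1]; exact (hP0 n r i x).2
  have hq0 : ∀ (n r : ℕ) (x : ℝ),
      (n : ℝ)⁻¹ * ∑ i : Fin n, observedProb r i x ∈ Set.Icc (0 : ℝ) 1 := by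
    intro n r x
    refine ⟨mul_nonneg (by positivity) (Finset.sum_nonneg fun i _ => (hP0 n r i x).1), ?_⟩
    calc (n : ℝ)⁻¹ * ∑ i : Fin n, observedProb r i x ≤ (n : ℝ)⁻¹ * ∑ i : Fin n, (1 : ℝ) := by
          gcongr with i; exact (hP0 n r i x).2
      _ ≤ 1 := by simpa using inv_mul_le_one
  have e : ∀ n : ℕ, (n : ℝ)⁻¹ *
      ∫ v, totalContribution n (r n) ρ v * totalContribution n (r n) τ v ∂unifSample n =
      ∫ x, ρ x * τ x * ((n : ℝ)⁻¹ * ∑ i : Fin n, observedProb (r n) i x) ∂unif := by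
    intro n
    rw [integral_totalContribution_mul n (r n) hρ hτ h2 h2',
      ← integral_finsetSum _ fun i _ => hPi n (r n) i, ← integral_const_mul]
    refine integral_congr_ae (ae_of_all _ fun x => ?_)
    simp only [← Finset.mul_sum]; ring
  have elim : ∫ x in (0 : ℝ)..p, ρ x * τ x =
      ∫ x, ρ x * τ x * (Set.Iio p).indicator (fun _ => 1) x ∂unif := by
    rw [← setIntegral_unif_Iio hp, ← integral_indicator measurableSet_Iio]
    refine integral_congr_ae (ae_of_all _ fun x => ?_)
    by_cases h : x < p <;> simp [h]
  simp only [e]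
  rw [elim]
  refine tendsto_integral_of_dominated_convergence (fun x => ‖ρ x * τ x‖) ?_ iρτ.norm ?_ ?_
  · intro n
    refine iρτ.aestronglyMeasurable.mul (StronglyMeasurable.aestronglyMeasurable ?_)
    exact (Finset.stronglyMeasurable_fun_sum _ fun i _ => hPm n (r n) i).const_mul _
  · refine fun n => ae_of_all _ fun x => ?_
    rw [norm_mul]
    refine mul_le_of_le_one_right (norm_nonneg _) ?_
    rw [Real.norm_of_nonneg (hq0 n (r n) x).1]; exact (hq0 n (r n) x).2
  · have hne : ∀ᵐ x ∂unif, x ≠ p := by simp [ae_iff]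
    filter_upwards [ae_unif_mem, hne] with x hx hxp
    exact (tendsto_average_observedProb hr hx hxp).const_mul _

/-! ### Order statistics -/

lemma orderStat_eq {n : ℕ} (x : Fin n → ℝ) (k : Fin n) :
    orderStat x (k + 1) = x (Tuple.sort x k) := by
  have : 1 ≤ (k : ℕ) + 1 ∧ (k : ℕ) + 1 ≤ n := ⟨by omega, k.isLt⟩
  rw [orderStat, dif_pos this]
  rfl

lemma exists_orderStat_eq {n : ℕ} (x : Fin n → ℝ) {k : ℕ} (h1 : 1 ≤ k) (hn : k ≤ n) :
    ∃ i, orderStat x k = x i := by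
  rw [orderStat, dif_pos ⟨h1, hn⟩]; exact ⟨_, rfl⟩

/-- Increasing transformations of the data commute with order statistics. -/
lemma orderStat_comp {n : ℕ} (x : Fin n → ℝ) {F : ℝ → ℝ} {s : Set ℝ} (hF : MonotoneOn F s)
    (hx : ∀ i, x i ∈ s) {k : ℕ} (h1 : 1 ≤ k) (hn : k ≤ n) :
    orderStat (fun i => F (x i)) k = F (orderStat x k) := by
  have hmono : Monotone ((fun i => F (x i)) ∘ Tuple.sort x) := fun a b hab =>
    hF (hx _) (hx _) (Tuple.monotone_sort x hab)
  have := (Tuple.comp_sort_eq_comp_iff_monotone (f := fun i => F (x i))).2 hmono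
  rw [orderStat, orderStat, dif_pos ⟨h1, hn⟩, dif_pos ⟨h1, hn⟩]
  exact (congrFun this _).symm

/-- Fewer than `r` of the data are below `s` exactly if the `r`-th order statistic is at
least `s`. -/
lemma numBefore_lt_iff {n : ℕ} (v : Fin n → ℝ) (k : Fin n) {i : Fin n} {s : ℝ} (hs : s ≤ v i) :
    numBefore i v s < k + 1 ↔ s ≤ v (Tuple.sort v k) := by
  have hmono := Tuple.monotone_sort v
  have hcard : numBefore i v s = (Finset.univ.filter fun j => v (Tuple.sort v j) < s).card := by
    rw [numBefore]
    symm
    refine Finset.card_bij (fun j _ => Tuple.sort v j) ?_ (fun a _ b _ h => by simpa using h) ?_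
    · intro j hj
      simp only [Finset.mem_filter, Finset.mem_univ, true_and] at hj ⊢
      exact ⟨fun h => by rw [h] at hj; exact not_lt.2 hs hj, hj⟩
    · intro j hj
      simp only [Finset.mem_filter, Finset.mem_univ, true_and] at hj
      exact ⟨(Tuple.sort v).symm j, by simpa using hj.2, by simp⟩
  rw [hcard]
  constructor
  · intro h
    by_contra hlt
    have hsub : Finset.Iic k ⊆ Finset.univ.filter fun j => v (Tuple.sort v j) < s := by
      intro j hj
      simp only [Finset.mem_filter, Finset.mem_univ, true_and]
      exact (hmono (Finset.mem_Iic.1 hj)).trans_lt (not_le.1 hlt)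
    have := Finset.card_le_card hsub
    rw [Fin.card_Iic] at this
    omega
  · intro h
    have hsub : (Finset.univ.filter fun j => v (Tuple.sort v j) < s) ⊆ Finset.Iio k := by
      intro j hj
      simp only [Finset.mem_filter, Finset.mem_univ, true_and] at hj
      by_contra hk
      have : k ≤ j := by simpa using hk
      exact not_lt.2 (h.trans (hmono this)) hj
    have := Finset.card_le_card hsub
    rw [Fin.card_Iio] at this
    omega

/-- A variable that is observed contributes its compensated value, a censored one minus the
compensator at the end of the observation. -/
lemma contribution_eq {n : ℕ} {ρ : ℝ → ℝ} (hρ : Integrable ρ unif) (v : Fin n → ℝ)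
    (hv : ∀ i, v i < 1) (k i : Fin n) :
    contribution (k + 1) ρ i v = if v i ≤ v (Tuple.sort v k) then compensated ρ (v i)
      else -compensator ρ (v (Tuple.sort v k)) := by
  set T := v (Tuple.sort v k) with hT
  have hobs : ∀ s ≤ v i, observed (k + 1) i v s = if s ≤ T then 1 else 0 := by
    intro s hs
    rw [observed]
    simp only [numBefore_lt_iff v k hs, hT]
  split_ifs with h
  · rw [contribution, compensated, compensated, hobs _ le_rfl, if_pos h, mul_one,
      compensator_congr (g' := ρ) fun s hs => by rw [hobs s hs.le, if_pos (hs.le.trans h), mul_one]]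
  · rw [contribution, compensated, hobs _ le_rfl, if_neg h, mul_zero,
      compensator_congr (g' := fun s => if s ≤ T then ρ s else 0) fun s hs => by
        rw [hobs s hs.le]; split_ifs <;> simp,
      compensator_piecewise (q := fun _ => 0) hρ (by simp) (not_le.1 h).le (hv i)]
    simp [compensator]

/-- The compensated sum in terms of order statistics, in the absence of ties. -/
lemma totalContribution_eq {n r : ℕ} (hr1 : 1 ≤ r) (hrn : r ≤ n) {ρ : ℝ → ℝ}
    (hρ : Integrable ρ unif) (v : Fin n → ℝ) (hv : ∀ i, v i < 1) (hinj : Function.Injective v) :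
    totalContribution n r ρ v = ∑ k ∈ Finset.Icc 1 r, compensated ρ (orderStat v k) -
      (n - r : ℕ) * compensator ρ (orderStat v r) := by
  obtain ⟨k, rfl⟩ : ∃ k : Fin n, r = k + 1 := ⟨⟨r - 1, by omega⟩, by simp; omega⟩
  have hmono := Tuple.monotone_sort v
  have hstrict : StrictMono (v ∘ Tuple.sort v) :=
    hmono.strictMono_of_injective (hinj.comp (Tuple.sort v).injective)
  set f : ℕ → ℝ := fun m => if m < k + 1 then compensated ρ (orderStat v (m + 1))
    else -compensator ρ (orderStat v (k + 1)) with hf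
  have h1 : totalContribution n (k + 1) ρ v = ∑ m ∈ Finset.range n, f m := by
    rw [totalContribution, ← Equiv.sum_comp (Tuple.sort v), ← Fin.sum_univ_eq_sum_range]
    refine Finset.sum_congr rfl fun j _ => ?_
    rw [contribution_eq hρ v hv]
    have hjk : v (Tuple.sort v j) ≤ v (Tuple.sort v k) ↔ (j : ℕ) < k + 1 := by
      rw [Nat.lt_succ_iff]; exact hstrict.le_iff_le
    simp only [hf, hjk, orderStat_eq]
  rw [h1, ← Finset.sum_range_add_sum_Ico f hrn, sub_eq_add_neg]
  congr 1
  · rw [show Finset.Icc 1 ((k : ℕ) + 1) = Finset.Ico (0 + 1) ((k : ℕ) + 1 + 1) from by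
      ext; simp only [Finset.mem_Icc, Finset.mem_Ico]; omega, ← Finset.sum_Ico_add',
      Finset.range_eq_Ico]
    exact Finset.sum_congr rfl fun m hm => by simp only [hf]; rw [if_pos (Finset.mem_Ico.1 hm).2]
  · rw [Finset.sum_congr rfl (g := fun _ => -compensator ρ (orderStat v (k + 1)))]
    · simp
    · intro m hm
      simp only [hf]; rw [if_neg (not_lt.2 (Finset.mem_Ico.1 hm).1)]

lemma ae_injective_unifSample (n : ℕ) : ∀ᵐ v ∂unifSample n, Function.Injective v := by
  have key : ∀ i j : Fin n, i ≠ j → ∀ᵐ v ∂unifSample n, v i ≠ v j := by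
    intro i j hij
    have hm : MeasurableSet {v : Fin n → ℝ | v i ≠ v j} :=
      (measurableSet_eq_fun (measurable_pi_apply i) (measurable_pi_apply j)).compl
    rw [← (measurePreserving_update_unifSample i).map_eq,
      ae_map_iff measurable_update'.aemeasurable hm]
    refine (Measure.ae_prod_iff_ae_ae (p := fun z : (Fin n → ℝ) × ℝ =>
      Function.update z.1 i z.2 i ≠ Function.update z.1 i z.2 j) (measurable_update' hm)).2
      (ae_of_all _ fun v => ?_)
    have : ∀ᵐ t ∂unif, t ≠ v j := by simp [ae_iff]
    filter_upwards [this] with t ht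
    simpa [Function.update_of_ne hij.symm] using ht
  have : ∀ᵐ v ∂unifSample n, ∀ i j : Fin n, i ≠ j → v i ≠ v j :=
    ae_all_iff.2 fun i => ae_all_iff.2 fun j => by
      by_cases h : i = j
      · simp [h]
      · filter_upwards [key i j h] with v hv _ using hv
  filter_upwards [this] with v hv i j hij
  by_contra h
  exact hv i j h hij

/-! ### The logarithmic derivatives of hazard and survival function -/

/-- The partial derivatives of the logarithm of the hazard rate `f / (1 - F)` in the three
parameters, as functions of `z = 1 - exp (-(x / σ) ^ β)`. -/
def hazardScore (α β σ : ℝ) : Fin 3 → ℝ → ℝ :=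
  ![fun z => 1 / α + Real.log z / (1 - z ^ α),
    fun z => (1 + Real.log (-Real.log (1 - z)) * psi z α) / β,
    fun z => -(β / σ) * psi z α]

/-- The common factor of the derivatives of the log-survival function in `β` and `σ`. -/
def survivalFactor (α z : ℝ) : ℝ := z ^ α / (1 - z ^ α) * ((1 - z) / z) * Real.log (1 - z)

/-- The partial derivatives of the logarithm of the survival function `1 - F` in the three
parameters, as functions of `z = 1 - exp (-(x / σ) ^ β)`. -/
def survivalScore (α β σ : ℝ) : Fin 3 → ℝ → ℝ :=
  ![fun z => -(z ^ α * Real.log z / (1 - z ^ α)),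
    fun z => α / β * (survivalFactor α z * Real.log (-Real.log (1 - z))),
    fun z => -(α * β / σ) * survivalFactor α z]

lemma rpow_mem_Ioo {z a : ℝ} (ha : 0 < a) (hz : z ∈ Set.Ioo (0 : ℝ) 1) :
    z ^ a ∈ Set.Ioo (0 : ℝ) 1 :=
  ⟨Real.rpow_pos_of_pos hz.1 a, Real.rpow_lt_one hz.1.le hz.2 ha⟩

lemma hasDerivAt_log_one_sub {z : ℝ} (hz : z < 1) :
    HasDerivAt (fun z => Real.log (1 - z)) (-1 / (1 - z)) z := by
  have := ((hasDerivAt_const z (1 : ℝ)).sub (hasDerivAt_id z)).log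
    (by simp only [Pi.sub_apply, id]; linarith)
  simpa using this

lemma hasDerivAt_survivalFactor {α z : ℝ} (hα : 0 < α) (hz : z ∈ Set.Ioo (0 : ℝ) 1) :
    HasDerivAt (survivalFactor α) (-(z ^ α / z * psi z α / (1 - z ^ α))) z := by
  obtain ⟨hZ0, hZ1⟩ := rpow_mem_Ioo hα hz
  have hz0 := hz.1.ne'
  have hz1 : 1 - z ≠ 0 := by linarith [hz.2]
  have hZ : 1 - z ^ α ≠ 0 := by linarith
  have d1 : HasDerivAt (fun z : ℝ => z ^ α) (α * (z ^ α / z)) z := by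
    have := Real.hasDerivAt_rpow_const (x := z) (p := α) (Or.inl hz0)
    rwa [Real.rpow_sub_one hz0] at this
  have d2 := d1.fun_div (d1.const_sub 1) hZ
  have d3 := ((hasDerivAt_id z).const_sub 1).fun_div (hasDerivAt_id z) hz0
  have := (d2.fun_mul d3).fun_mul (hasDerivAt_log_one_sub hz.2)
  refine (this.congr_deriv ?_)
  unfold psi
  simp only [id]
  generalize z ^ α = Z at *
  generalize Real.log (1 - z) = l at *
  field_simp
  ring

lemma neg_log_one_sub_pos {z : ℝ} (hz : z ∈ Set.Ioo (0 : ℝ) 1) : 0 < -Real.log (1 - z) :=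
  neg_pos.2 (Real.log_neg (by linarith [hz.2]) (by linarith [hz.1]))

/-- Along the data the log-survival score decreases at the rate "hazard score times hazard". -/
lemma hasDerivAt_survivalScore {α β σ z : ℝ} (hα : 0 < α) (hβ : 0 < β)
    (hz : z ∈ Set.Ioo (0 : ℝ) 1) (i : Fin 3) :
    HasDerivAt (survivalScore α β σ i)
      (-(hazardScore α β σ i z * (α * (z ^ α / z)) / (1 - z ^ α))) z := by
  obtain ⟨hZ0, hZ1⟩ := rpow_mem_Ioo hα hz
  have hz0 := hz.1.ne'
  have hz1 : 1 - z ≠ 0 := by linarith [hz.2]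
  have hZ : 1 - z ^ α ≠ 0 := by linarith
  have d1 : HasDerivAt (fun z : ℝ => z ^ α) (α * (z ^ α / z)) z := by
    have := Real.hasDerivAt_rpow_const (x := z) (p := α) (Or.inl hz0)
    rwa [Real.rpow_sub_one hz0] at this
  fin_cases i
  · have := ((d1.fun_mul (Real.hasDerivAt_log hz0)).fun_div (d1.const_sub 1) hZ).fun_neg
    refine this.congr_deriv ?_
    simp only [hazardScore, Fin.zero_eta, Matrix.cons_val_zero]
    generalize z ^ α = Z at *
    field_simp
    ring
  · have hu := neg_log_one_sub_pos hz
    have d2 := (hasDerivAt_log_one_sub hz.2).fun_neg.log hu.ne'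
    have := ((hasDerivAt_survivalFactor hα hz).fun_mul d2).const_mul (α / β)
    refine this.congr_deriv ?_
    simp only [hazardScore, Fin.mk_one, Matrix.cons_val_one, Matrix.cons_val_zero]
    have hl : Real.log (1 - z) ≠ 0 := by linarith
    unfold survivalFactor
    generalize Real.log (-Real.log (1 - z)) = m at *
    generalize psi z α = ψ at *
    generalize z ^ α = Z at *
    generalize Real.log (1 - z) = l at *
    field_simp
    ring
  · have := (hasDerivAt_survivalFactor hα hz).const_mul (-(α * β / σ))
    refine this.congr_deriv ?_
    simp only [hazardScore, Fin.reduceFinMk, Matrix.cons_val]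
    ring

lemma tendsto_survivalScore {α β σ : ℝ} (hα : 0 < α) (i : Fin 3) :
    Tendsto (survivalScore α β σ i) (𝓝[>] 0) (𝓝 0) := by
  have t0 : Tendsto (fun z : ℝ => z ^ α) (𝓝[>] 0) (𝓝 0) := by
    have := (Real.continuousAt_rpow_const 0 α (Or.inr hα.le)).tendsto
    rw [Real.zero_rpow hα.ne'] at this
    exact this.mono_left nhdsWithin_le_nhds
  have t1 : Tendsto (fun z : ℝ => 1 - z ^ α) (𝓝[>] 0) (𝓝 1) := by
    simpa using t0.const_sub 1
  have tlog := tendsto_log_mul_rpow_nhdsGT_zero hα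
  have tslope : Tendsto (fun z : ℝ => z⁻¹ * Real.log (1 - z)) (𝓝[>] 0) (𝓝 (-1)) := by
    have h : HasDerivAt (fun z => Real.log (1 - z)) (-1 : ℝ) 0 := by
      simpa using hasDerivAt_log_one_sub (z := 0) one_pos
    have := (hasDerivAt_iff_tendsto_slope_zero.1 h).mono_left
      (nhdsWithin_mono 0 fun x (hx : 0 < x) => hx.ne' : 𝓝[>] (0 : ℝ) ≤ 𝓝[≠] 0)
    simpa using this
  have tone : Tendsto (fun z : ℝ => 1 - z) (𝓝[>] 0) (𝓝 1) := by
    have : Tendsto (fun z : ℝ => 1 - z) (𝓝 0) (𝓝 (1 - 0)) :=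
      (continuous_const.sub continuous_id).tendsto 0
    rw [sub_zero] at this
    exact this.mono_left nhdsWithin_le_nhds
  -- the survival factor is `z ^ α` times a function with a finite limit
  have tfac : Tendsto (fun z : ℝ => (1 - z) / (1 - z ^ α) * (z⁻¹ * Real.log (1 - z)))
      (𝓝[>] 0) (𝓝 (1 / 1 * -1)) := (tone.div t1 one_ne_zero).mul tslope
  have efac : ∀ z, survivalFactor α z =
      z ^ α * ((1 - z) / (1 - z ^ α) * (z⁻¹ * Real.log (1 - z))) := by
    intro z; rw [survivalFactor]; simp only [div_eq_mul_inv]; ring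
  have tu : Tendsto (fun z : ℝ => z ^ α * Real.log (-Real.log (1 - z))) (𝓝[>] 0) (𝓝 0) := by
    refine squeeze_zero_norm' ?_ (by simpa using tlog.norm)
    filter_upwards [Ioo_mem_nhdsGT (show (0 : ℝ) < 1 / 2 by norm_num)] with z hz
    have hzu : z ≤ -Real.log (1 - z) := by
      have := Real.log_le_sub_one_of_pos (show 0 < 1 - z by linarith [hz.2])
      linarith
    have hu1 : -Real.log (1 - z) ≤ 1 := by
      have h := Real.one_sub_inv_le_log_of_pos (show 0 < 1 - z by linarith [hz.2])
      have : (1 - z)⁻¹ ≤ 2 := by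
        rw [inv_le_comm₀ (by linarith [hz.2]) two_pos]; linarith [hz.2]
      linarith
    have h1 : Real.log (-Real.log (1 - z)) ≤ 0 := Real.log_nonpos (hz.1.le.trans hzu) hu1
    have h2 : Real.log z ≤ Real.log (-Real.log (1 - z)) := Real.log_le_log hz.1 hzu
    have h3 : 0 ≤ z ^ α := Real.rpow_nonneg hz.1.le _
    rw [norm_mul, mul_comm, Real.norm_eq_abs, abs_of_nonpos h1, Real.norm_eq_abs,
      abs_of_nonneg h3, abs_of_nonpos (h2.trans h1)]
    gcongr
  fin_cases i
  · have := (tlog.div t1 one_ne_zero).neg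
    simp only [zero_div, neg_zero] at this
    refine this.congr fun z => ?_
    simp [survivalScore, mul_comm]
  · have := (tu.mul tfac).const_mul (α / β)
    simp only [zero_mul, mul_zero] at this
    refine this.congr fun z => ?_
    simp only [survivalScore, efac, Fin.mk_one, Matrix.cons_val_one, Matrix.cons_val_zero]
    ring
  · have := (t0.mul tfac).const_mul (-(α * β / σ))
    simp only [zero_mul, mul_zero] at this
    refine this.congr fun z => ?_
    simp only [survivalScore, efac, Fin.reduceFinMk, Matrix.cons_val]

/-! ### Square integrability of the hazard score -/

lemma measurable_psi (α : ℝ) : Measurable fun z => psi z α := by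
  unfold psi; fun_prop

lemma measurable_hazardScore (α β σ : ℝ) (i : Fin 3) : Measurable (hazardScore α β σ i) := by
  have := measurable_psi α
  fin_cases i
  · show Measurable fun z : ℝ => 1 / α + Real.log z / (1 - z ^ α)
    fun_prop
  · show Measurable fun z : ℝ => (1 + Real.log (-Real.log (1 - z)) * psi z α) / β
    fun_prop
  · show Measurable fun z : ℝ => -(β / σ) * psi z α
    fun_prop

/-- For `α ≤ 1` this is Bernoulli's inequality. -/
lemma one_sub_div_one_sub_rpow_le {α z : ℝ} (hα : 0 < α) (hz : z ∈ Set.Ioo (0 : ℝ) 1) :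
    (1 - z) / (1 - z ^ α) ≤ 1 + 1 / α := by
  obtain ⟨hZ0, hZ1⟩ := rpow_mem_Ioo hα hz
  rw [div_le_iff₀ (by linarith)]
  have hα' : 0 < 1 / α := by positivity
  rcases le_total 1 α with h | h
  · have : z ^ α ≤ z := by
      simpa using Real.rpow_le_rpow_of_exponent_ge hz.1 hz.2.le h
    nlinarith
  · have := _root_.rpow_one_add_le_one_add_mul_self (s := z - 1) (by linarith [hz.1]) hα.le h
    rw [add_sub_cancel] at this
    have h2 : 1 - z ≤ 1 / α * (1 - z ^ α) := by
      rw [div_mul_eq_mul_div, one_mul, le_div_iff₀ hα]; linarith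
    nlinarith

lemma neg_log_div_one_sub_le {w : ℝ} (hw : w ∈ Set.Ioo (0 : ℝ) 1) :
    -Real.log w / (1 - w) ≤ 1 - Real.log w := by
  rw [div_le_iff₀ (by linarith [hw.2])]
  have h := Real.one_sub_inv_le_log_of_pos hw.1
  have : w * (1 - Real.log w) ≤ 1 := by
    calc w * (1 - Real.log w) ≤ w * w⁻¹ := by
          have := hw.1; gcongr; linarith
      _ = 1 := mul_inv_cancel₀ hw.1.ne'
  linarith

lemma abs_psi_le {α z : ℝ} (hα : 0 < α) (hz : z ∈ Set.Ioo (0 : ℝ) 1) :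
    |psi z α| ≤ (α + 4) * (1 - Real.log (1 - z)) := by
  have hu := neg_log_one_sub_pos hz
  set u := -Real.log (1 - z) with hudef
  have hlog : Real.log (1 - z) = -u := by rw [hudef, neg_neg]
  obtain ⟨hZ0, hZ1⟩ := rpow_mem_Ioo hα hz
  have hq := one_sub_div_one_sub_rpow_le hα hz
  have hq0 : 0 ≤ (1 - z) / (1 - z ^ α) := div_nonneg (by linarith [hz.2]) (by linarith)
  have hw : u / z ≤ 1 + u := by
    have := neg_log_div_one_sub_le (w := 1 - z) ⟨by linarith [hz.2], by linarith [hz.1]⟩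
    rw [← hudef, sub_sub_cancel] at this
    linarith
  have hw0 : 0 ≤ u / z := div_nonneg hu.le hz.1.le
  have e : psi z α = 1 - u - u / z * (1 - z) + α * (u / z * ((1 - z) / (1 - z ^ α))) := by
    have hz0 := hz.1.ne'
    have hZ : 1 - z ^ α ≠ 0 := by linarith
    rw [psi, hlog]; field_simp; ring
  have h1 : u / z * (1 - z) ≤ 1 + u := by
    have : u / z * (1 - z) ≤ u / z := mul_le_of_le_one_right hw0 (by linarith [hz.1])
    linarith
  have h2 : α * (u / z * ((1 - z) / (1 - z ^ α))) ≤ α * ((1 + u) * (1 + 1 / α)) := by gcongr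
  have h3 : α * ((1 + u) * (1 + 1 / α)) = (α + 1) * (1 + u) := by field_simp
  have h4 : 0 ≤ u / z * (1 - z) := mul_nonneg hw0 (by linarith [hz.2])
  have h5 : 0 ≤ α * (u / z * ((1 - z) / (1 - z ^ α))) := by positivity
  rw [e, hlog, abs_le]
  constructor <;> nlinarith

/-- All three hazard scores grow at most like squares of logarithms at both ends. -/
lemma exists_abs_hazardScore_le {α β : ℝ} (σ : ℝ) (hα : 0 < α) (hβ : 0 < β) (i : Fin 3) :
    ∃ C, 0 ≤ C ∧ ∀ z ∈ Set.Ioo (0 : ℝ) 1,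
      |hazardScore α β σ i z| ≤ C * (1 - Real.log z - Real.log (1 - z)) ^ 2 := by
  have hpsi : ∀ z ∈ Set.Ioo (0 : ℝ) 1, |psi z α| ≤
      (α + 4) * (1 - Real.log z - Real.log (1 - z)) := fun z hz =>
    (abs_psi_le hα hz).trans (by
      have := Real.log_neg hz.1 hz.2
      gcongr; linarith)
  have hL : ∀ z ∈ Set.Ioo (0 : ℝ) 1, 1 ≤ 1 - Real.log z - Real.log (1 - z) := fun z hz => by
    have := Real.log_neg hz.1 hz.2
    have := neg_log_one_sub_pos hz
    linarith
  fin_cases i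
  · refine ⟨2 / α + 1, by positivity, fun z hz => ?_⟩
    show |1 / α + Real.log z / (1 - z ^ α)| ≤ _
    have hZ := rpow_mem_Ioo hα hz
    have h1 := neg_log_div_one_sub_le hZ
    rw [Real.log_rpow hz.1] at h1
    have hl := Real.log_neg hz.1 hz.2
    have h2 : |Real.log z / (1 - z ^ α)| ≤ 1 / α - Real.log z := by
      rw [abs_div, abs_of_neg hl, abs_of_pos (by linarith [hZ.2])]
      have : -Real.log z / (1 - z ^ α) = 1 / α * (-(α * Real.log z) / (1 - z ^ α)) := by
        field_simp
      rw [this]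
      calc 1 / α * (-(α * Real.log z) / (1 - z ^ α)) ≤ 1 / α * (1 - α * Real.log z) := by gcongr
        _ = 1 / α - Real.log z := by field_simp
    have hL' := hL z hz
    have hu := neg_log_one_sub_pos hz
    set L := 1 - Real.log z - Real.log (1 - z) with hLdef
    have h3 : 1 / α - Real.log z ≤ (1 / α + 1) * L := by
      have : 0 < 1 / α := by positivity
      nlinarith
    have h4 : (1 : ℝ) / α ≤ 1 / α * L := le_mul_of_one_le_right (by positivity) hL'
    calc |1 / α + Real.log z / (1 - z ^ α)| ≤ |1 / α| + |Real.log z / (1 - z ^ α)| := abs_add_le _ _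
      _ ≤ 1 / α * L + (1 / α + 1) * L := by
          rw [abs_of_pos (by positivity : 0 < 1 / α)]; linarith
      _ = (2 / α + 1) * L := by ring
      _ ≤ (2 / α + 1) * L ^ 2 := by gcongr; nlinarith
  · refine ⟨(1 + (α + 4)) / β, by positivity, fun z hz => ?_⟩
    show |(1 + Real.log (-Real.log (1 - z)) * psi z α) / β| ≤ _
    have hL' := hL z hz
    have hψ := hpsi z hz
    have hu := neg_log_one_sub_pos hz
    have hl := Real.log_neg hz.1 hz.2
    set u := -Real.log (1 - z) with hudef
    -- `z ≤ u` and `log u ≤ u`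
    have hzu : z ≤ u := by
      have := Real.log_le_sub_one_of_pos (show 0 < 1 - z by linarith [hz.2])
      linarith
    have h1 : |Real.log u| ≤ 1 - Real.log z - Real.log (1 - z) := by
      rw [abs_le]
      have := Real.log_le_log hz.1 hzu
      have := Real.log_le_self hu.le
      constructor <;> linarith
    set L := 1 - Real.log z - Real.log (1 - z) with hLdef
    rw [abs_div, abs_of_pos hβ, div_mul_eq_mul_div]
    gcongr
    calc |1 + Real.log u * psi z α| ≤ |1| + |Real.log u * psi z α| := abs_add_le _ _
      _ ≤ 1 + L * ((α + 4) * L) := by rw [abs_one, abs_mul]; gcongr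
      _ ≤ (1 + (α + 4)) * L ^ 2 := by nlinarith
  · refine ⟨|-(β / σ)| * (α + 4), by positivity, fun z hz => ?_⟩
    show |-(β / σ) * psi z α| ≤ _
    have hL' := hL z hz
    rw [abs_mul, mul_assoc]
    gcongr
    refine (hpsi z hz).trans ?_
    gcongr
    nlinarith

/-- The hazard score as a function of `F(x; θ) = z ^ α`, which is uniformly distributed. -/
def unifScore (α β σ : ℝ) (i : Fin 3) (s : ℝ) : ℝ := hazardScore α β σ i (s ^ (1 / α))

lemma measurable_unifScore (α β σ : ℝ) (i : Fin 3) : Measurable (unifScore α β σ i) :=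
  (measurable_hazardScore α β σ i).comp (measurable_id.pow_const _)

lemma integrable_log_pow_four : Integrable (fun x => Real.log x ^ 4) unif ∧
    Integrable (fun x => Real.log (1 - x) ^ 4) unif := by
  have hb : ∀ x ∈ Set.Ioo (0 : ℝ) 1, Real.log x ^ 4 ≤ 8 ^ 4 * x ^ (-(1 / 2) : ℝ) := by
    intro x hx
    have h := Real.abs_log_mul_self_rpow_lt x (1 / 8) hx.1 hx.2.le (by norm_num)
    have hpos : 0 < x ^ (1 / 8 : ℝ) := Real.rpow_pos_of_pos hx.1 _
    rw [abs_mul, abs_of_pos hpos] at h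
    have h8 : |Real.log x| * x ^ (1 / 8 : ℝ) ≤ 8 := by norm_num at h ⊢; exact h.le
    have h4 : (|Real.log x| * x ^ (1 / 8 : ℝ)) ^ 4 ≤ 8 ^ 4 :=
      pow_le_pow_left₀ (by positivity) h8 4
    rw [mul_pow, (even_iff_two_dvd.2 (by norm_num) : Even 4).pow_abs,
      ← Real.rpow_mul_natCast hx.1.le] at h4
    rw [Real.rpow_neg hx.1.le, ← div_eq_mul_inv, le_div_iff₀ (Real.rpow_pos_of_pos hx.1 _)]
    norm_num at h4 ⊢
    exact h4
  have i0 : IntervalIntegrable (fun x : ℝ => 8 ^ 4 * x ^ (-(1 / 2) : ℝ)) volume 0 1 :=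
    (intervalIntegral.intervalIntegrable_rpow' (by norm_num)).const_mul _
  have i1 : IntervalIntegrable (fun x : ℝ => 8 ^ 4 * (1 - x) ^ (-(1 / 2) : ℝ)) volume 0 1 := by
    have := i0.comp_sub_left 1
    simp only [sub_zero, sub_self] at this
    exact this.symm
  have toU : ∀ {f : ℝ → ℝ}, IntervalIntegrable f volume 0 1 → Integrable f unif := fun h =>
    (intervalIntegrable_iff_integrableOn_Ioo_of_le zero_le_one).1 h
  have hlog : Measurable fun x : ℝ => Real.log x ^ 4 := by fun_prop
  have hlog' : Measurable fun x : ℝ => Real.log (1 - x) ^ 4 := by fun_prop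
  refine ⟨(toU i0).mono' hlog.aestronglyMeasurable ?_, (toU i1).mono' hlog'.aestronglyMeasurable ?_⟩
  · filter_upwards [ae_unif_mem] with x hx
    rw [Real.norm_of_nonneg (by positivity)]
    exact hb x hx
  · filter_upwards [ae_unif_mem] with x hx
    rw [Real.norm_of_nonneg (by positivity)]
    exact hb (1 - x) ⟨by linarith [hx.2], by linarith [hx.1]⟩

lemma memLp_unifScore {α β : ℝ} (σ : ℝ) (hα : 0 < α) (hβ : 0 < β) (i : Fin 3) :
    MemLp (unifScore α β σ i) 2 unif := by
  obtain ⟨C, hC0, hC⟩ := exists_abs_hazardScore_le σ hα hβ i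
  have hαi : 0 < 1 / α := by positivity
  have hlogα : 0 < Real.log (1 + α) := Real.log_pos (by linarith)
  set D : ℝ := 1 + Real.log (1 + α) + 1 / α with hD
  have hmain : MemLp (fun s => (1 - Real.log s - Real.log (1 - s)) ^ 2) 2 unif := by
    have hm : Measurable fun s : ℝ => (1 - Real.log s - Real.log (1 - s)) ^ 2 := by fun_prop
    rw [memLp_two_iff_integrable_sq hm.aestronglyMeasurable]
    have hint : Integrable (fun s => 27 * (1 + Real.log s ^ 4 + Real.log (1 - s) ^ 4)) unif :=
      (((integrable_const 1).add integrable_log_pow_four.1).add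
        integrable_log_pow_four.2).const_mul 27
    refine hint.mono' (hm.pow_const 2).aestronglyMeasurable (ae_of_all _ fun s => ?_)
    rw [Real.norm_of_nonneg (by positivity)]
    generalize Real.log s = a
    generalize Real.log (1 - s) = b
    -- convexity of the square, used twice
    have h1 : (1 - a - b) ^ 2 ≤ 3 * (1 + a ^ 2 + b ^ 2) := by
      nlinarith [sq_nonneg (1 + a), sq_nonneg (1 + b), sq_nonneg (a - b)]
    have h2 : (1 + a ^ 2 + b ^ 2) ^ 2 ≤ 3 * (1 + a ^ 4 + b ^ 4) := by
      nlinarith [sq_nonneg (1 - a ^ 2), sq_nonneg (1 - b ^ 2), sq_nonneg (a ^ 2 - b ^ 2)]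
    calc ((1 - a - b) ^ 2) ^ 2 ≤ (3 * (1 + a ^ 2 + b ^ 2)) ^ 2 :=
          pow_le_pow_left₀ (sq_nonneg _) h1 2
      _ ≤ 27 * (1 + a ^ 4 + b ^ 4) := by rw [mul_pow]; linarith
  refine (hmain.const_mul (C * D ^ 2)).mono (measurable_unifScore α β σ i).aestronglyMeasurable ?_
  filter_upwards [ae_unif_mem] with s hs
  have hz := rpow_mem_Ioo hαi hs
  have hq := one_sub_div_one_sub_rpow_le hαi hs
  rw [one_div_one_div] at hq
  have hls := Real.log_neg hs.1 hs.2
  have hls' := neg_log_one_sub_pos hs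
  have hlz : Real.log (s ^ (1 / α)) = 1 / α * Real.log s := Real.log_rpow hs.1 _
  have hlz' : Real.log (1 - s) - Real.log (1 + α) ≤ Real.log (1 - s ^ (1 / α)) := by
    rw [div_le_iff₀ (by linarith [hz.2])] at hq
    have := Real.log_le_log (by linarith [hs.2]) hq
    rw [Real.log_mul (by positivity) (by linarith [hz.2])] at this
    linarith
  have hlzn := neg_log_one_sub_pos hz
  have hL : 1 - Real.log (s ^ (1 / α)) - Real.log (1 - s ^ (1 / α)) ≤
      D * (1 - Real.log s - Real.log (1 - s)) := by
    rw [hlz, hD]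
    nlinarith [mul_pos hlogα (neg_pos.2 hls), mul_pos hlogα hls', mul_pos hαi hls']
  have hL0 : 0 ≤ 1 - Real.log (s ^ (1 / α)) - Real.log (1 - s ^ (1 / α)) := by
    have := Real.log_neg hz.1 hz.2
    linarith
  rw [Real.norm_eq_abs, Real.norm_of_nonneg (by positivity)]
  calc |unifScore α β σ i s|
      ≤ C * (1 - Real.log (s ^ (1 / α)) - Real.log (1 - s ^ (1 / α))) ^ 2 := hC _ hz
    _ ≤ C * (D * (1 - Real.log s - Real.log (1 - s))) ^ 2 := by gcongr
    _ = C * D ^ 2 * (1 - Real.log s - Real.log (1 - s)) ^ 2 := by ring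

/-- The compensator of the hazard score is minus the derivative of the log-survival function. -/
lemma compensator_unifScore {α β : ℝ} (σ : ℝ) (hα : 0 < α) (hβ : 0 < β) (i : Fin 3) {s : ℝ}
    (hs : s ∈ Set.Ioo (0 : ℝ) 1) :
    compensator (unifScore α β σ i) s = -survivalScore α β σ i (s ^ (1 / α)) := by
  have hαi : 0 < 1 / α := by positivity
  have hderiv : ∀ t ∈ Set.Ioo (0 : ℝ) 1, HasDerivAt
      (fun t => -survivalScore α β σ i (t ^ (1 / α))) (unifScore α β σ i t / (1 - t)) t := by
    intro t ht
    have hz := rpow_mem_Ioo hαi ht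
    have d1 : HasDerivAt (fun t : ℝ => t ^ (1 / α)) (1 / α * (t ^ (1 / α) / t)) t := by
      have := Real.hasDerivAt_rpow_const (x := t) (p := 1 / α) (Or.inl ht.1.ne')
      rwa [Real.rpow_sub_one ht.1.ne'] at this
    have := ((hasDerivAt_survivalScore (σ := σ) hα hβ hz i).comp t d1).neg
    refine this.congr_deriv ?_
    have e : (t ^ (1 / α)) ^ α = t := by
      rw [← Real.rpow_mul ht.1.le, one_div_mul_cancel hα.ne', Real.rpow_one]
    rw [e, unifScore]
    have h0 := hz.1.ne'
    have ht0 := ht.1.ne'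
    have ht1 : 1 - t ≠ 0 := by linarith [ht.2]
    generalize hazardScore α β σ i (t ^ (1 / α)) = R
    generalize t ^ (1 / α) = Z at *
    field_simp
  rw [compensator, setIntegral_unif_Iio hs]
  have hint : IntervalIntegrable (fun t => unifScore α β σ i t / (1 - t)) volume 0 s := by
    rw [intervalIntegrable_iff_integrableOn_Ioo_of_le hs.1.le]
    have h := integrableOn_div_Iio ((memLp_unifScore σ hα hβ i).integrable one_le_two) hs.2
    rwa [IntegrableOn, unif, Measure.restrict_restrict measurableSet_Iio,
      Iio_inter_Ioo_zero_one hs] at h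
  have hpow : Tendsto (fun t : ℝ => t ^ (1 / α)) (𝓝[>] 0) (𝓝[>] 0) := by
    refine tendsto_nhdsWithin_iff.2 ⟨?_, ?_⟩
    · have := (Real.continuousAt_rpow_const 0 (1 / α) (Or.inr hαi.le)).tendsto
      rw [Real.zero_rpow hαi.ne'] at this
      exact this.mono_left nhdsWithin_le_nhds
    · filter_upwards [self_mem_nhdsWithin] with t ht using Real.rpow_pos_of_pos ht _
  have h0 : Tendsto (fun t => -survivalScore α β σ i (t ^ (1 / α))) (𝓝[>] 0) (𝓝 0) := by
    simpa using ((tendsto_survivalScore (β := β) (σ := σ) hα i).comp hpow).neg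
  have := intervalIntegral.integral_eq_sub_of_hasDerivAt_of_tendsto hs.1
    (fun t ht => hderiv t ⟨ht.1, ht.2.trans hs.2⟩) hint h0
    ((hderiv s hs).continuousAt.tendsto.mono_left nhdsWithin_le_nhds)
  rw [this, sub_zero]

lemma compensated_unifScore {α β : ℝ} (σ : ℝ) (hα : 0 < α) (hβ : 0 < β) (i : Fin 3) {s : ℝ}
    (hs : s ∈ Set.Ioo (0 : ℝ) 1) :
    compensated (unifScore α β σ i) s =
      hazardScore α β σ i (s ^ (1 / α)) + survivalScore α β σ i (s ^ (1 / α)) := by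
  rw [compensated, compensator_unifScore σ hα hβ i hs, unifScore, sub_neg_eq_add]

/-! ### The probability integral transform -/

lemma cdf_of_pos {α β σ x : ℝ} (hx : 0 < x) :
    cdf ![α, β, σ] x = (1 - Real.exp (-(x / σ) ^ β)) ^ α := by simp [cdf, hx]

lemma weibullCdf_mem {β σ x : ℝ} (hσ : 0 < σ) (hx : 0 < x) :
    1 - Real.exp (-(x / σ) ^ β) ∈ Set.Ioo (0 : ℝ) 1 := by
  have h1 : 0 < (x / σ) ^ β := Real.rpow_pos_of_pos (by positivity) _
  have h2 : Real.exp (-(x / σ) ^ β) < 1 := by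
    rw [← Real.exp_zero]; exact Real.exp_lt_exp.2 (by linarith)
  have h3 := Real.exp_pos (-(x / σ) ^ β)
  constructor <;> linarith

lemma cdf_mem {α β σ x : ℝ} (hα : 0 < α) (hσ : 0 < σ) (hx : 0 < x) :
    cdf ![α, β, σ] x ∈ Set.Ioo (0 : ℝ) 1 := by
  rw [cdf_of_pos hx]; exact rpow_mem_Ioo hα (weibullCdf_mem hσ hx)

lemma strictMonoOn_cdf {α β σ : ℝ} (hα : 0 < α) (hβ : 0 < β) (hσ : 0 < σ) :
    StrictMonoOn (cdf ![α, β, σ]) (Set.Ioi 0) := by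
  intro x hx y hy hxy
  have hx' : 0 < x := hx
  have hy' : 0 < y := hy
  rw [cdf_of_pos hx', cdf_of_pos hy']
  refine Real.rpow_lt_rpow (weibullCdf_mem hσ hx').1.le ?_ hα
  have : (x / σ) ^ β < (y / σ) ^ β :=
    Real.rpow_lt_rpow (by positivity) (div_lt_div_of_pos_right hxy hσ) hβ
  have := Real.exp_lt_exp.2 (neg_lt_neg this)
  linarith

lemma image_cdf {α β σ : ℝ} (hα : 0 < α) (hβ : 0 < β) (hσ : 0 < σ) :
    cdf ![α, β, σ] '' Set.Ioi 0 = Set.Ioo 0 1 := by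
  ext y
  constructor
  · rintro ⟨x, hx, rfl⟩
    exact cdf_mem hα hσ hx
  · intro hy
    have hz := rpow_mem_Ioo (one_div_pos.2 hα) hy
    have hu := neg_log_one_sub_pos hz
    have hx : 0 < σ * (-Real.log (1 - y ^ (1 / α))) ^ (1 / β) :=
      mul_pos hσ (Real.rpow_pos_of_pos hu _)
    refine ⟨_, hx, ?_⟩
    rw [cdf_of_pos hx, mul_div_cancel_left₀ _ hσ.ne', ← Real.rpow_mul hu.le,
      one_div_mul_cancel hβ.ne', Real.rpow_one, neg_neg, Real.exp_log (by linarith [hz.2]),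
      sub_sub_cancel, ← Real.rpow_mul hy.1.le, one_div_mul_cancel hα.ne', Real.rpow_one]

lemma hasDerivAt_cdf {α β σ x : ℝ} (hσ : 0 < σ) (hx : 0 < x) :
    HasDerivAt (cdf ![α, β, σ]) (pdf ![α, β, σ] x) x := by
  have hz := weibullCdf_mem (β := β) hσ hx
  have hxσ : x / σ ≠ 0 := by positivity
  have d1 : HasDerivAt (fun x : ℝ => x / σ) (1 / σ) x := (hasDerivAt_id x).div_const σ
  have d2 := (((d1.rpow_const (p := β) (Or.inl hxσ)).fun_neg.exp).const_sub 1).rpow_const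
    (p := α) (Or.inl hz.1.ne')
  have e : (fun x : ℝ => (1 - Real.exp (-(x / σ) ^ β)) ^ α) =ᶠ[𝓝 x] cdf ![α, β, σ] := by
    filter_upwards [lt_mem_nhds hx] with y hy using (cdf_of_pos hy).symm
  refine (d2.congr_of_eventuallyEq e.symm).congr_deriv ?_
  simp only [pdf, hx, if_true, Matrix.cons_val]
  ring

lemma pdf_nonneg {α β σ : ℝ} (hα : 0 < α) (hβ : 0 < β) (hσ : 0 < σ) (x : ℝ) :
    0 ≤ pdf ![α, β, σ] x := by
  unfold pdf
  split_ifs with hx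
  · have h1 := (weibullCdf_mem (β := β) hσ hx).1
    simp only [Matrix.cons_val]
    have h2 : 0 < x / σ := by positivity
    positivity
  · exact le_rfl

lemma measurable_cdf (θ : Fin 3 → ℝ) : Measurable (cdf θ) := by
  unfold cdf
  exact Measurable.ite measurableSet_Ioi (by fun_prop) measurable_const

/-- The distribution function of a lifetime is uniformly distributed. -/
lemma measurePreserving_cdf {α β σ : ℝ} (hα : 0 < α) (hβ : 0 < β) (hσ : 0 < σ) :
    MeasurePreserving (cdf ![α, β, σ]) (law ![α, β, σ]) unif := by
  have hm := measurable_cdf ![α, β, σ]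
  refine ⟨hm, ?_⟩
  ext E hE
  rw [Measure.map_apply hm hE, law, withDensity_apply _ (hm hE), ← lintegral_indicator (hm hE)]
  have e : ∀ x, (cdf ![α, β, σ] ⁻¹' E).indicator (fun x => ENNReal.ofReal (pdf ![α, β, σ] x)) x =
      (Set.Ioi 0).indicator (fun x => ENNReal.ofReal |pdf ![α, β, σ] x| *
        E.indicator 1 (cdf ![α, β, σ] x)) x := by
    intro x
    by_cases hx : 0 < x
    · rw [Set.indicator_of_mem (s := Set.Ioi 0) hx, abs_of_nonneg (pdf_nonneg hα hβ hσ x)]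
      by_cases h : cdf ![α, β, σ] x ∈ E <;> simp [h]
    · rw [Set.indicator_of_notMem (s := Set.Ioi 0) hx]
      have : pdf ![α, β, σ] x = 0 := by simp [pdf, hx]
      simp [this]
  simp only [e]
  rw [lintegral_indicator measurableSet_Ioi, ← lintegral_image_eq_lintegral_abs_deriv_mul
    measurableSet_Ioi (fun x hx => (hasDerivAt_cdf hσ hx).hasDerivWithinAt)
    (strictMonoOn_cdf hα hβ hσ).injOn, image_cdf hα hβ hσ, lintegral_indicator_one hE, unif]

lemma measurePreserving_cdf_sample {α β σ : ℝ} (hα : 0 < α) (hβ : 0 < β) (hσ : 0 < σ) (n : ℕ) :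
    MeasurePreserving (fun (x : Fin n → ℝ) i => cdf ![α, β, σ] (x i)) (sampleLaw ![α, β, σ] n)
      (unifSample n) :=
  measurePreserving_pi _ _ fun _ => measurePreserving_cdf hα hβ hσ

/-! ### The score of the censored sample -/

lemma log_pdf {α β σ x : ℝ} (hα : 0 < α) (hβ : 0 < β) (hσ : 0 < σ) (hx : 0 < x) :
    Real.log (pdf ![α, β, σ] x) = Real.log α + Real.log β - Real.log σ +
      (β - 1) * (Real.log x - Real.log σ) - Real.exp (β * (Real.log x - Real.log σ)) +
      (α - 1) * Real.log (1 - Real.exp (-Real.exp (β * (Real.log x - Real.log σ)))) := by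
  have hxσ : 0 < x / σ := by positivity
  have hz := (weibullCdf_mem (β := β) hσ hx).1
  have hw : (x / σ) ^ β = Real.exp (β * (Real.log x - Real.log σ)) := by
    rw [Real.rpow_def_of_pos hxσ, Real.log_div hx.ne' hσ.ne', mul_comm]
  have e : pdf ![α, β, σ] x = α * β / σ * (x / σ) ^ (β - 1) * Real.exp (-(x / σ) ^ β) *
      (1 - Real.exp (-(x / σ) ^ β)) ^ (α - 1) := by simp [pdf, hx]
  have h1 : 0 < (x / σ) ^ (β - 1) := Real.rpow_pos_of_pos hxσ _
  have h2 : 0 < (1 - Real.exp (-(x / σ) ^ β)) ^ (α - 1) := Real.rpow_pos_of_pos hz _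
  rw [e, Real.log_mul (by positivity) h2.ne', Real.log_mul (by positivity) (Real.exp_ne_zero _),
    Real.log_mul (by positivity) h1.ne', Real.log_div (by positivity) hσ.ne',
    Real.log_mul hα.ne' hβ.ne', Real.log_rpow hxσ, Real.log_rpow hz, Real.log_exp, hw,
    Real.log_div hx.ne' hσ.ne']
  ring

lemma pdf_pos {α β σ x : ℝ} (hα : 0 < α) (hβ : 0 < β) (hσ : 0 < σ) (hx : 0 < x) :
    0 < pdf ![α, β, σ] x := by
  have h1 := (weibullCdf_mem (β := β) hσ hx).1
  simp only [pdf, hx, if_true, Matrix.cons_val]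
  have h2 : 0 < x / σ := by positivity
  positivity

lemma log_one_sub_cdf {α β σ x : ℝ} (hσ : 0 < σ) (hx : 0 < x) :
    Real.log (1 - cdf ![α, β, σ] x) = Real.log (1 - (1 - Real.exp (-Real.exp (β *
      (Real.log x - Real.log σ)))) ^ α) := by
  have hxσ : 0 < x / σ := by positivity
  rw [cdf_of_pos hx, Real.rpow_def_of_pos hxσ, Real.log_div hx.ne' hσ.ne', mul_comm β]

/-- The derivative of `u ↦ log (1 - exp (-u))` along a curve with `u' = m u`, and that of the
log-survival function. -/
lemma hasDerivAt_log_weibullCdf {α t m : ℝ} {u : ℝ → ℝ} (hα : 0 < α)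
    (hu : HasDerivAt u (m * u t) t) (hpos : 0 < u t) :
    HasDerivAt (fun t => Real.log (1 - Real.exp (-u t)))
      (m * u t * Real.exp (-u t) / (1 - Real.exp (-u t))) t ∧
    HasDerivAt (fun t => Real.log (1 - (1 - Real.exp (-u t)) ^ α))
      (m * α * survivalFactor α (1 - Real.exp (-u t))) t := by
  have h1 : Real.exp (-u t) < 1 := by rw [← Real.exp_zero]; exact Real.exp_lt_exp.2 (by linarith)
  have h0 := Real.exp_pos (-u t)
  have hz : 1 - Real.exp (-u t) ∈ Set.Ioo (0 : ℝ) 1 := ⟨by linarith, by linarith⟩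
  have hZ := rpow_mem_Ioo hα hz
  have d1 := hu.fun_neg.exp.const_sub 1
  have d2 := d1.log hz.1.ne'
  have d3 := ((d1.rpow_const (p := α) (Or.inl hz.1.ne')).const_sub 1).log
    (by linarith [hZ.2])
  refine ⟨d2.congr_deriv (by ring), d3.congr_deriv ?_⟩
  have e : Real.log (1 - (1 - Real.exp (-u t))) = -u t := by rw [sub_sub_cancel, Real.log_exp]
  rw [survivalFactor, e, Real.rpow_sub_one hz.1.ne', sub_sub_cancel]
  have hz0 := hz.1.ne'
  have hZ1 : 1 - (1 - Real.exp (-u t)) ^ α ≠ 0 := by linarith [hZ.2]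
  generalize (1 - Real.exp (-u t)) ^ α = Z at *
  field_simp

lemma update_zero (α β σ t : ℝ) : Function.update ![α, β, σ] 0 t = ![t, β, σ] := by
  ext i; fin_cases i <;> simp [Function.update]

lemma update_one (α β σ t : ℝ) : Function.update ![α, β, σ] 1 t = ![α, t, σ] := by
  ext i; fin_cases i <;> simp [Function.update]

lemma update_two (α β σ t : ℝ) : Function.update ![α, β, σ] 2 t = ![α, β, t] := by
  ext i; fin_cases i <;> simp [Function.update]

/-- Small changes of one parameter keep all parameters positive. -/
lemma eventually_update_pos {α β σ : ℝ} (hα : 0 < α) (hβ : 0 < β) (hσ : 0 < σ) (i : Fin 3) :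
    ∀ᶠ t in 𝓝 (![α, β, σ] i), ∃ a b s : ℝ, 0 < a ∧ 0 < b ∧ 0 < s ∧
      Function.update ![α, β, σ] i t = ![a, b, s] := by
  fin_cases i
  · filter_upwards [lt_mem_nhds hα] with t ht using ⟨_, _, _, ht, hβ, hσ, update_zero _ _ _ _⟩
  · filter_upwards [lt_mem_nhds hβ] with t ht using ⟨_, _, _, hα, ht, hσ, update_one _ _ _ _⟩
  · filter_upwards [lt_mem_nhds hσ] with t ht using ⟨_, _, _, hα, hβ, ht, update_two _ _ _ _⟩

/-- The partial derivatives of log-density and log-survival function. -/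
lemma hasDerivAt_log_pdf_and_log_survival {α β σ x : ℝ} (hα : 0 < α) (hβ : 0 < β) (hσ : 0 < σ)
    (hx : 0 < x) (i : Fin 3) :
    HasDerivAt (fun t => Real.log (pdf (Function.update ![α, β, σ] i t) x))
      (hazardScore α β σ i (1 - Real.exp (-(x / σ) ^ β)) +
        survivalScore α β σ i (1 - Real.exp (-(x / σ) ^ β))) (![α, β, σ] i) ∧
    HasDerivAt (fun t => Real.log (1 - cdf (Function.update ![α, β, σ] i t) x))
      (survivalScore α β σ i (1 - Real.exp (-(x / σ) ^ β))) (![α, β, σ] i) := by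
  have hxσ : 0 < x / σ := by positivity
  set w := Real.log x - Real.log σ with hw
  have hu : (x / σ) ^ β = Real.exp (β * w) := by
    rw [Real.rpow_def_of_pos hxσ, Real.log_div hx.ne' hσ.ne', mul_comm]
  have hz := weibullCdf_mem (β := β) hσ hx
  rw [hu] at hz ⊢
  set z := 1 - Real.exp (-Real.exp (β * w)) with hzdef
  have hez : Real.exp (-Real.exp (β * w)) = 1 - z := by rw [hzdef]; ring
  have hlog : Real.log (1 - z) = -Real.exp (β * w) := by rw [← hez, Real.log_exp]
  have hloglog : Real.log (-Real.log (1 - z)) = β * w := by rw [hlog, neg_neg, Real.log_exp]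
  have hZ := rpow_mem_Ioo hα hz
  have hz0 := hz.1.ne'
  have hZ1 : 1 - z ^ α ≠ 0 := by linarith [hZ.2]
  fin_cases i
  · simp only [Fin.zero_eta, Matrix.cons_val_zero, update_zero]
    constructor
    · have d := ((Real.hasDerivAt_log hα.ne').add_const (Real.log β - Real.log σ +
        (β - 1) * w - Real.exp (β * w))).fun_add
        (((hasDerivAt_id α).sub_const 1).mul_const (Real.log z))
      refine (d.congr_of_eventuallyEq ?_).congr_deriv ?_
      · filter_upwards [lt_mem_nhds hα] with t ht
        rw [log_pdf ht hβ hσ hx]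
        simp only [id, ← hw, ← hzdef]; ring
      · simp only [hazardScore, survivalScore, Matrix.cons_val_zero]
        field_simp
        ring
    · have d := ((Real.hasStrictDerivAt_const_rpow hz.1 α).hasDerivAt.const_sub 1).log hZ1
      refine (d.congr_of_eventuallyEq ?_).congr_deriv ?_
      · filter_upwards with t
        rw [log_one_sub_cdf hσ hx]
      · simp only [survivalScore, Matrix.cons_val_zero]; ring
  · simp only [Fin.mk_one, Matrix.cons_val_one, Matrix.cons_val_zero, update_one]
    have du : HasDerivAt (fun b : ℝ => Real.exp (b * w)) (w * Real.exp (β * w)) β := by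
      have := ((hasDerivAt_id β).mul_const w).exp
      exact this.congr_deriv (by simp only [id]; ring)
    obtain ⟨d1, d2⟩ := hasDerivAt_log_weibullCdf hα du (Real.exp_pos _)
    constructor
    · have d := ((((Real.hasDerivAt_log hβ.ne').add_const (Real.log α - Real.log σ)).fun_add
        (((hasDerivAt_id β).sub_const 1).mul_const w)).fun_sub du).fun_add (d1.const_mul (α - 1))
      refine (d.congr_of_eventuallyEq ?_).congr_deriv ?_
      · filter_upwards [lt_mem_nhds hβ] with t ht
        rw [log_pdf hα ht hσ hx]
        simp only [id, ← hw]; ring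
      · simp only [hazardScore, survivalScore, survivalFactor, psi, Matrix.cons_val_one,
          Matrix.cons_val_zero, hez, hlog, neg_neg, Real.log_exp, sub_sub_cancel]
        generalize z ^ α = Z at *
        generalize Real.exp (β * w) = u at *
        field_simp
        ring
    · refine (d2.congr_of_eventuallyEq ?_).congr_deriv ?_
      · filter_upwards with t
        rw [log_one_sub_cdf hσ hx]
      · simp only [survivalScore, Matrix.cons_val_one, Matrix.cons_val_zero, ← hzdef, hloglog]
        field_simp
  · simp only [Fin.reduceFinMk, Matrix.cons_val, update_two]
    have dw : HasDerivAt (fun s : ℝ => Real.log x - Real.log s) (-(1 / σ)) σ := by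
      simpa using (Real.hasDerivAt_log hσ.ne').const_sub (Real.log x)
    have du : HasDerivAt (fun s : ℝ => Real.exp (β * (Real.log x - Real.log s)))
        (-(β / σ) * Real.exp (β * (Real.log x - Real.log σ))) σ := by
      have := (dw.const_mul β).exp
      exact this.congr_deriv (by ring)
    obtain ⟨d1, d2⟩ := hasDerivAt_log_weibullCdf hα du (Real.exp_pos _)
    constructor
    · have d := ((((Real.hasDerivAt_log hσ.ne').const_sub (Real.log α + Real.log β)).fun_add
        (dw.const_mul (β - 1))).fun_sub du).fun_add (d1.const_mul (α - 1))
      refine (d.congr_of_eventuallyEq ?_).congr_deriv ?_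
      · filter_upwards [lt_mem_nhds hσ] with t ht
        rw [log_pdf hα hβ ht hx]
      · simp only [hazardScore, survivalScore, survivalFactor, psi, Matrix.cons_val,
          ← hw, hez, hlog, sub_sub_cancel]
        generalize z ^ α = Z at *
        generalize Real.exp (β * w) = u at *
        field_simp
        ring
    · refine (d2.congr_of_eventuallyEq ?_).congr_deriv ?_
      · filter_upwards [lt_mem_nhds hσ] with t ht
        rw [log_one_sub_cdf ht hx]
      · simp only [survivalScore, Matrix.cons_val, ← hw, ← hzdef]
        field_simp

/-- The score of the censored sample: every observed lifetime contributes the derivative of the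
log-density, every censored one that of the log-survival function at the end of observation. -/
lemma hasDerivAt_logLikelihoodAlong {α β σ : ℝ} (hα : 0 < α) (hβ : 0 < β) (hσ : 0 < σ)
    {n r : ℕ} (hr : 1 ≤ r) {y : ℕ → ℝ} (hy : ∀ k ∈ Finset.Icc 1 r, 0 < y k) (i : Fin 3) :
    HasDerivAt (logLikelihoodAlong n r y ![α, β, σ] i)
      (∑ k ∈ Finset.Icc 1 r, (hazardScore α β σ i (1 - Real.exp (-(y k / σ) ^ β)) +
        survivalScore α β σ i (1 - Real.exp (-(y k / σ) ^ β))) +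
        (n - r : ℕ) * survivalScore α β σ i (1 - Real.exp (-(y r / σ) ^ β))) (![α, β, σ] i) := by
  have hyr := hy r (Finset.mem_Icc.2 ⟨hr, le_rfl⟩)
  have d := ((HasDerivAt.fun_sum fun k hk =>
    (hasDerivAt_log_pdf_and_log_survival hα hβ hσ (hy k hk) i).1).const_add
      (Real.log ((n.factorial : ℝ) / ((n - r).factorial : ℝ)))).fun_add
    ((hasDerivAt_log_pdf_and_log_survival hα hβ hσ hyr i).2.const_mul ((n - r : ℕ) : ℝ))
  refine d.congr_of_eventuallyEq ?_
  filter_upwards [eventually_update_pos hα hβ hσ i] with t ⟨a, b, s, ha, hb, hs, e⟩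
  rw [logLikelihoodAlong, likelihood, e]
  have hpdf : ∀ k ∈ Finset.Icc 1 r, pdf ![a, b, s] (y k) ≠ 0 := fun k hk =>
    (pdf_pos ha hb hs (hy k hk)).ne'
  have hS : 0 < 1 - cdf ![a, b, s] (y r) := by linarith [(cdf_mem (β := b) ha hs hyr).2]
  have hprod := Finset.prod_ne_zero_iff.2 hpdf
  have hc : (n.factorial : ℝ) / ((n - r).factorial : ℝ) ≠ 0 :=
    div_ne_zero (by positivity) (by positivity)
  rw [Real.log_mul (mul_ne_zero hc hprod) (pow_ne_zero _ hS.ne'), Real.log_mul hc hprod,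
    Real.log_prod hpdf, Real.log_pow]

lemma ae_sampleLaw_pos {α β σ : ℝ} (hα : 0 < α) (hβ : 0 < β) (hσ : 0 < σ) (n : ℕ) :
    ∀ᵐ x ∂sampleLaw ![α, β, σ] n, ∀ i, 0 < x i := by
  filter_upwards [(measurePreserving_cdf_sample hα hβ hσ n).quasiMeasurePreserving.ae
    (ae_unifSample_mem n)] with x hx i
  by_contra h
  have := (hx i).1
  simp [cdf, h] at this

/-- After the probability integral transform, the score is the compensated sum of the hazard
score. -/
lemma score_ae_eq {α β σ : ℝ} (hα : 0 < α) (hβ : 0 < β) (hσ : 0 < σ) {n r : ℕ} (hr1 : 1 ≤ r)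
    (hrn : r ≤ n) (i : Fin 3) :
    (fun x => score n r (orderStat x) ![α, β, σ] i) =ᵐ[sampleLaw ![α, β, σ] n] fun x =>
      totalContribution n r (unifScore α β σ i) (fun j => cdf ![α, β, σ] (x j)) := by
  have hq := (measurePreserving_cdf_sample hα hβ hσ n).quasiMeasurePreserving
  filter_upwards [ae_sampleLaw_pos hα hβ hσ n, hq.ae (ae_unifSample_mem n),
    hq.ae (ae_injective_unifSample n)] with x hx hv hinj
  have hy : ∀ k ∈ Finset.Icc 1 r, 0 < orderStat x k := by
    intro k hk
    rw [Finset.mem_Icc] at hk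
    obtain ⟨j, hj⟩ := exists_orderStat_eq x hk.1 (hk.2.trans hrn)
    rw [hj]; exact hx j
  have hord : ∀ k ∈ Finset.Icc 1 r, orderStat (fun j => cdf ![α, β, σ] (x j)) k =
      cdf ![α, β, σ] (orderStat x k) := by
    intro k hk
    rw [Finset.mem_Icc] at hk
    exact orderStat_comp x (strictMonoOn_cdf hα hβ hσ).monotoneOn hx hk.1 (hk.2.trans hrn)
  have hroot : ∀ k ∈ Finset.Icc 1 r, cdf ![α, β, σ] (orderStat x k) ^ (1 / α) =
      1 - Real.exp (-(orderStat x k / σ) ^ β) := by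
    intro k hk
    rw [cdf_of_pos (hy k hk), ← Real.rpow_mul (weibullCdf_mem hσ (hy k hk)).1.le,
      mul_one_div_cancel hα.ne', Real.rpow_one]
  have hrmem : r ∈ Finset.Icc 1 r := Finset.mem_Icc.2 ⟨hr1, le_rfl⟩
  rw [score, (hasDerivAt_logLikelihoodAlong hα hβ hσ hr1 hy i).deriv,
    totalContribution_eq hr1 hrn ((memLp_unifScore σ hα hβ i).integrable one_le_two) _
      (fun j => (hv j).2) hinj, hord r hrmem,
    compensator_unifScore σ hα hβ i (cdf_mem hα hσ (hy r hrmem)), hroot r hrmem, mul_neg,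
    sub_neg_eq_add]
  congr 1
  refine Finset.sum_congr rfl fun k hk => ?_
  rw [hord k hk, compensated_unifScore σ hα hβ i (cdf_mem hα hσ (hy k hk)), hroot k hk]

lemma fisherInformationExists {α β σ : ℝ} (hα : 0 < α) (hβ : 0 < β) (hσ : 0 < σ) {n r : ℕ}
    (hr1 : 1 ≤ r) (hrn : r ≤ n) : FisherInformationExists ![α, β, σ] n r := by
  constructor
  · filter_upwards [ae_sampleLaw_pos hα hβ hσ n] with x hx i
    refine (hasDerivAt_logLikelihoodAlong hα hβ hσ hr1 (fun k hk => ?_) i).differentiableAt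
    rw [Finset.mem_Icc] at hk
    obtain ⟨j, hj⟩ := exists_orderStat_eq x hk.1 (hk.2.trans hrn)
    rw [hj]; exact hx j
  · intro i j
    have hL := fun i => memLp_totalContribution n r (measurable_unifScore α β σ i)
      (memLp_unifScore σ hα hβ i)
    have hint : Integrable (fun v => totalContribution n r (unifScore α β σ i) v *
        totalContribution n r (unifScore α β σ j) v) (unifSample n) := (hL i).integrable_mul (hL j)
    refine ((measurePreserving_cdf_sample hα hβ hσ n).integrable_comp_of_integrable hint).congr ?_
    filter_upwards [score_ae_eq hα hβ hσ hr1 hrn i, score_ae_eq hα hβ hσ hr1 hrn j] with x h1 h2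
    rw [h1, h2]; rfl

lemma fisherInformation_apply {α β σ : ℝ} (hα : 0 < α) (hβ : 0 < β) (hσ : 0 < σ) {n r : ℕ}
    (hr1 : 1 ≤ r) (hrn : r ≤ n) (i j : Fin 3) :
    fisherInformation ![α, β, σ] n r i j =
      ∫ v, totalContribution n r (unifScore α β σ i) v *
        totalContribution n r (unifScore α β σ j) v ∂unifSample n := by
  have hmp := measurePreserving_cdf_sample hα hβ hσ n
  have hL := fun i => memLp_totalContribution n r (measurable_unifScore α β σ i)
    (memLp_unifScore σ hα hβ i)
  conv_rhs => rw [← hmp.map_eq]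
  rw [integral_map hmp.measurable.aemeasurable
    (by rw [hmp.map_eq]; exact (hL i).aestronglyMeasurable.mul (hL j).aestronglyMeasurable)]
  refine integral_congr_ae ?_
  filter_upwards [score_ae_eq hα hβ hσ hr1 hrn i, score_ae_eq hα hβ hσ hr1 hrn j] with x h1 h2
  rw [h1, h2]

lemma isLimitingFisherInformation {α β σ p : ℝ} (hα : 0 < α) (hβ : 0 < β) (hσ : 0 < σ)
    (hp : p ∈ Set.Ioo (0 : ℝ) 1) :
    IsLimitingFisherInformation ![α, β, σ] p
      (Matrix.of fun i j => ∫ s in (0 : ℝ)..p, unifScore α β σ i s * unifScore α β σ j s) := by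
  intro r hr
  refine ⟨fun n h1 hn => fisherInformationExists hα hβ hσ h1 hn, ?_⟩
  have hev : ∀ᶠ n : ℕ in atTop, 1 ≤ r n ∧ r n ≤ n := by
    filter_upwards [hr.eventually_const_lt hp.1, hr.eventually_lt_const hp.2,
      eventually_gt_atTop 0] with n h0 h1 hn
    have hn' : (0 : ℝ) < n := by exact_mod_cast hn
    constructor
    · by_contra h
      have : r n = 0 := by omega
      simp [this] at h0
    · rw [div_lt_one hn'] at h1
      exact_mod_cast h1.le
  refine tendsto_pi_nhds.2 fun i => tendsto_pi_nhds.2 fun j => ?_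
  have := tendsto_integral_totalContribution_mul hp hr (measurable_unifScore α β σ i)
    (measurable_unifScore α β σ j) (memLp_unifScore σ hα hβ i) (memLp_unifScore σ hα hβ j)
  refine this.congr' ?_
  filter_upwards [hev] with n hn
  rw [Matrix.smul_apply, fisherInformation_apply hα hβ hσ hn.1 hn.2, smul_eq_mul]

/-! ### The entries of the limit -/

/-- The substitution `s = x ^ α` on `(0, p)`. -/
lemma integral_comp_rpow_inv {α p : ℝ} (hα : 0 < α) (hp : 0 < p) (g : ℝ → ℝ) :
    (IntervalIntegrable (fun s => g (s ^ (1 / α))) volume 0 p ↔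
      IntervalIntegrable (fun x => g x * x ^ (α - 1)) volume 0 (p ^ (1 / α))) ∧
    ∫ s in (0 : ℝ)..p, g (s ^ (1 / α)) =
      α * ∫ x in (0 : ℝ)..(p ^ (1 / α)), g x * x ^ (α - 1) := by
  have hq : 0 < p ^ (1 / α) := Real.rpow_pos_of_pos hp _
  set G : ℝ → ℝ := (Set.Iio p).indicator fun s => g (s ^ (1 / α)) with hG
  have e : ∀ x ∈ Set.Ioi (0 : ℝ), (|α| * x ^ (α - 1)) • G (x ^ α) =
      (Set.Iio (p ^ (1 / α))).indicator (fun x => α * (g x * x ^ (α - 1))) x := by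
    intro x hx
    have hx0 : 0 < x := hx
    have hiff : x ^ α < p ↔ x < p ^ (1 / α) := by
      rw [one_div, Real.lt_rpow_inv_iff_of_pos hx0.le hp.le hα]
    have hroot : (x ^ α) ^ (1 / α) = x := by
      rw [← Real.rpow_mul hx0.le, mul_one_div_cancel hα.ne', Real.rpow_one]
    by_cases h : x < p ^ (1 / α)
    · rw [hG, Set.indicator_of_mem (Set.mem_Iio.2 (hiff.2 h)), Set.indicator_of_mem
        (Set.mem_Iio.2 h), hroot, abs_of_pos hα, smul_eq_mul]; ring
    · rw [hG, Set.indicator_of_notMem (s := Set.Iio p) (fun h' => h (hiff.1 h')),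
        Set.indicator_of_notMem (s := Set.Iio (p ^ (1 / α))) h,
        smul_zero]
  have hI : ∀ a : ℝ, Set.Iio a ∩ Set.Ioi 0 = Set.Ioo 0 a := fun a => by
    rw [Set.inter_comm, Set.Ioi_inter_Iio]
  have hint := integrableOn_Ioi_comp_rpow_iff G hα.ne'
  rw [integrableOn_congr_fun e measurableSet_Ioi, IntegrableOn, IntegrableOn, hG,
    integrable_indicator_iff measurableSet_Iio, integrable_indicator_iff measurableSet_Iio,
    IntegrableOn, IntegrableOn, Measure.restrict_restrict measurableSet_Iio,
    Measure.restrict_restrict measurableSet_Iio, hI, hI] at hint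
  have hval := integral_comp_rpow_Ioi G hα.ne'
  rw [setIntegral_congr_fun measurableSet_Ioi e, hG, integral_indicator measurableSet_Iio,
    integral_indicator measurableSet_Iio, Measure.restrict_restrict measurableSet_Iio,
    Measure.restrict_restrict measurableSet_Iio, hI, hI, integral_const_mul] at hval
  constructor
  · rw [intervalIntegrable_iff_integrableOn_Ioo_of_le hp.le,
      intervalIntegrable_iff_integrableOn_Ioo_of_le hq.le, IntegrableOn, ← hint,
      integrable_const_mul_iff hα.ne'.isUnit, IntegrableOn]
  · rw [intervalIntegral.integral_of_le hp.le, intervalIntegral.integral_of_le hq.le,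
      integral_Ioc_eq_integral_Ioo, integral_Ioc_eq_integral_Ioo, hval]

lemma intervalIntegrable_unifScore_mul {α β p : ℝ} (σ : ℝ) (hα : 0 < α) (hβ : 0 < β)
    (hp : p ∈ Set.Ioo (0 : ℝ) 1) (i j : Fin 3) :
    IntervalIntegrable (fun s => unifScore α β σ i s * unifScore α β σ j s) volume 0 p := by
  have h : Integrable (fun s => unifScore α β σ i s * unifScore α β σ j s) unif :=
    (memLp_unifScore σ hα hβ i).integrable_mul (memLp_unifScore σ hα hβ j)
  rw [intervalIntegrable_iff_integrableOn_Ioo_of_le hp.1.le]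
  exact IntegrableOn.mono_set (t := Set.Ioo 0 1) h (Set.Ioo_subset_Ioo_right hp.2.le)

end EWD

end

theorem mainTheorem1 (α β σ p : ℝ) (hα : 0 < α) (hβ : 0 < β) (hσ : 0 < σ)
    (hp0 : 0 < p) (hp1 : p < 1) :
    -- the integrals below converge
    (IntervalIntegrable (fun x : ℝ => (1 + Real.log x / (1 - x)) ^ 2) volume 0 p ∧
      IntervalIntegrable
        (fun x : ℝ => (1 + Real.log (-Real.log (1 - x)) * EWD.psi x α) ^ 2 * x ^ (α - 1))
        volume 0 (p ^ (1 / α)) ∧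
      IntervalIntegrable (fun x : ℝ => EWD.psi x α ^ 2 * x ^ (α - 1))
        volume 0 (p ^ (1 / α)) ∧
      IntervalIntegrable
        (fun x : ℝ => (1 / α + Real.log x / (1 - x ^ α)) *
          (1 + Real.log (-Real.log (1 - x)) * EWD.psi x α) * x ^ (α - 1))
        volume 0 (p ^ (1 / α)) ∧
      IntervalIntegrable
        (fun x : ℝ => (1 / α + Real.log x / (1 - x ^ α)) * EWD.psi x α * x ^ (α - 1))
        volume 0 (p ^ (1 / α)) ∧
      IntervalIntegrable
        (fun x : ℝ => (1 + Real.log (-Real.log (1 - x)) * EWD.psi x α) * EWD.psi x α *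
          x ^ (α - 1))
        volume 0 (p ^ (1 / α))) ∧
    -- the limiting Fisher information matrix exists and has the following entries
    ∃ I : Matrix (Fin 3) (Fin 3) ℝ,
      EWD.IsLimitingFisherInformation ![α, β, σ] p I ∧
      I 0 0 = 1 / α ^ 2 * ∫ x in (0 : ℝ)..p, (1 + Real.log x / (1 - x)) ^ 2 ∧
      I 1 1 = α / β ^ 2 * ∫ x in (0 : ℝ)..(p ^ (1 / α)),
        (1 + Real.log (-Real.log (1 - x)) * EWD.psi x α) ^ 2 * x ^ (α - 1) ∧
      I 2 2 = α * (β / σ) ^ 2 * ∫ x in (0 : ℝ)..(p ^ (1 / α)),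
        EWD.psi x α ^ 2 * x ^ (α - 1) ∧
      I 0 1 = I 1 0 ∧
      I 0 1 = α / β * ∫ x in (0 : ℝ)..(p ^ (1 / α)),
        (1 / α + Real.log x / (1 - x ^ α)) *
          (1 + Real.log (-Real.log (1 - x)) * EWD.psi x α) * x ^ (α - 1) ∧
      I 0 2 = I 2 0 ∧
      I 0 2 = -(α * β / σ) * ∫ x in (0 : ℝ)..(p ^ (1 / α)),
        (1 / α + Real.log x / (1 - x ^ α)) * EWD.psi x α * x ^ (α - 1) ∧
      I 1 2 = I 2 1 ∧
      I 1 2 = -(α / σ) * ∫ x in (0 : ℝ)..(p ^ (1 / α)),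
        (1 + Real.log (-Real.log (1 - x)) * EWD.psi x α) * EWD.psi x α * x ^ (α - 1) := by
  have hp : p ∈ Set.Ioo (0 : ℝ) 1 := ⟨hp0, hp1⟩
  have hI := fun i j => EWD.intervalIntegrable_unifScore_mul σ hα hβ hp i j
  have hT := fun i j => EWD.integral_comp_rpow_inv hα hp0
    (fun z => EWD.hazardScore α β σ i z * EWD.hazardScore α β σ j z)
  -- the integrand in the variable `x` is integrable for each pair of parameters
  have hJ := fun i j => (hT i j).1.1 (hI i j)
  have h00 : ∀ s ∈ Set.uIcc 0 p, EWD.unifScore α β σ 0 s * EWD.unifScore α β σ 0 s =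
      1 / α ^ 2 * (1 + Real.log s / (1 - s)) ^ 2 := by
    intro s hs
    rw [Set.uIcc_of_le hp0.le] at hs
    have e : EWD.unifScore α β σ 0 s = 1 / α * (1 + Real.log s / (1 - s)) := by
      simp only [EWD.unifScore, EWD.hazardScore, Matrix.cons_val_zero]
      rw [← Real.rpow_mul hs.1, one_div_mul_cancel hα.ne', Real.rpow_one]
      rcases hs.1.eq_or_lt with h | h
      · simp [← h, Real.zero_rpow (inv_ne_zero hα.ne')]
      · rw [Real.log_rpow h]; ring
    rw [e]; field_simp
  have hS1 : ∀ x, 1 + Real.log (-Real.log (1 - x)) * EWD.psi x α =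
      β * EWD.hazardScore α β σ 1 x := by
    intro x
    simp only [EWD.hazardScore, Matrix.cons_val_one, Matrix.cons_val_zero]
    field_simp
  have hS2 : ∀ x, EWD.psi x α = -(σ / β) * EWD.hazardScore α β σ 2 x := by
    intro x
    simp only [EWD.hazardScore, Matrix.cons_val]
    field_simp
  have hS0 : ∀ x, 1 / α + Real.log x / (1 - x ^ α) = EWD.hazardScore α β σ 0 x := by
    intro x
    simp only [EWD.hazardScore, Matrix.cons_val_zero]
  have e11 : ∀ x, (1 + Real.log (-Real.log (1 - x)) * EWD.psi x α) ^ 2 * x ^ (α - 1) =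
      β ^ 2 * (EWD.hazardScore α β σ 1 x * EWD.hazardScore α β σ 1 x * x ^ (α - 1)) := fun x => by
    rw [hS1]; ring
  have e22 : ∀ x, EWD.psi x α ^ 2 * x ^ (α - 1) =
      (σ / β) ^ 2 * (EWD.hazardScore α β σ 2 x * EWD.hazardScore α β σ 2 x * x ^ (α - 1)) :=
    fun x => by rw [hS2]; ring
  have e01 : ∀ x, (1 / α + Real.log x / (1 - x ^ α)) *
      (1 + Real.log (-Real.log (1 - x)) * EWD.psi x α) * x ^ (α - 1) =
      β * (EWD.hazardScore α β σ 0 x * EWD.hazardScore α β σ 1 x * x ^ (α - 1)) := fun x => by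
    rw [hS1, hS0]; ring
  have e02 : ∀ x, (1 / α + Real.log x / (1 - x ^ α)) * EWD.psi x α * x ^ (α - 1) =
      -(σ / β) * (EWD.hazardScore α β σ 0 x * EWD.hazardScore α β σ 2 x * x ^ (α - 1)) :=
    fun x => by rw [hS0, hS2]; ring
  have e12 : ∀ x, (1 + Real.log (-Real.log (1 - x)) * EWD.psi x α) * EWD.psi x α * x ^ (α - 1) =
      -σ * (EWD.hazardScore α β σ 1 x * EWD.hazardScore α β σ 2 x * x ^ (α - 1)) := fun x => by
    rw [hS1, hS2]; field_simp
  have i00 : IntervalIntegrable (fun x : ℝ => (1 + Real.log x / (1 - x)) ^ 2) volume 0 p := by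
    refine ((hI 0 0).const_mul (α ^ 2)).congr fun s hs => ?_
    rw [h00 s (Set.uIoc_subset_uIcc hs)]
    field_simp
  simp only [e11, e22, e01, e02, e12]
  refine ⟨⟨i00, (hJ 1 1).const_mul _, (hJ 2 2).const_mul _, (hJ 0 1).const_mul _,
    (hJ 0 2).const_mul _, (hJ 1 2).const_mul _⟩, _,
    EWD.isLimitingFisherInformation hα hβ hσ hp, ?_⟩
  simp only [Matrix.of_apply, intervalIntegral.integral_const_mul]
  have hval : ∀ i j, ∫ s in (0 : ℝ)..p, EWD.unifScore α β σ i s * EWD.unifScore α β σ j s =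
      α * ∫ x in (0 : ℝ)..(p ^ (1 / α)), EWD.hazardScore α β σ i x * EWD.hazardScore α β σ j x *
        x ^ (α - 1) := fun i j => (hT i j).2
  have hsymm : ∀ i j, ∫ s in (0 : ℝ)..p, EWD.unifScore α β σ i s * EWD.unifScore α β σ j s =
      ∫ s in (0 : ℝ)..p, EWD.unifScore α β σ j s * EWD.unifScore α β σ i s := fun i j => by
    simp only [mul_comm]
  refine ⟨?_, ?_, ?_, hsymm 0 1, ?_, hsymm 0 2, ?_, hsymm 1 2, ?_⟩
  · rw [intervalIntegral.integral_congr h00, intervalIntegral.integral_const_mul]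
  all_goals
    rw [hval]
    field_simp
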